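/- Let $X$ be a quandle with operation $*$ (acting from the right), let $G_X=\langle x\in X\mid x*y=y^{-1}xy\rangle$ be its associated group, and let $Y$ be an $X$-set, i.e. a set with a right action of $G_X$, written $r*g$. Let $(D_X,\rho)$ be the symmetric double of $X$: $D_X=X^{+1}\sqcup X^{-1}=\{x^{\varepsilon}\mid x\in X,\ \varepsilon=\pm1\}$ with $x^{\varepsilon}\star y^{\delta}=(x*y^{\delta})^{\varepsilon}$ and $\rho(x^{\varepsilon})=x^{-\varepsilon}$, where $x*y^{+1}=x*y$ and $x*y^{-1}$ is the unique $z$ with $z*y=x$. Regard $Y$ as a $(D_X,\rho)$-set through the homomorphism $\langle a\in D_X\mid a\star b=b^{-1}ab,\ \rho(a)=a^{-1}\rangle\to G_X$, $x^{\varepsilon}\mapsto x^{\varepsilon}$. Let $D$ be a diagram of a surface-link, i.e. the image of a closed surface locally flatly embedded in $\mathbb R^4$ under a generic projection to $\mathbb R^3$ (locally one, two or three transverse sheets, or a branch point), with over/under information along the double point curves. Its sheets are the components left after removing (neighbourhoods of) the lower double points, its semi-sheets are the components left after removing all double points, and its complementary regions are the components of its complement in $\mathbb R^3$. An orientation $o=(o_1,o_2)$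 of $D$ is represented by the normal orientation $n$ such that $(o_1,o_2,n)$ is right-handed. * An $X_Y$-coloring of an oriented diagram $(D,o)$ assigns an element of $X$ to each sheet and an element of $Y$ to each complementary region such that: at each double point curve, if the normal orientation of the upper sheet, labelled $x_3$, points from the lower sheet labelled $x_1$ to the lower sheet labelled $x_2$, then $x_1*x_3=x_2$; and if the normal orientation of a sheet labelled $x$ points, at a semi-sheet, from a region labelled $r_1$ to a region labelled $r_2$, then $r_1*x=r_2$. The set of these is $\mathrm{Col}_{X_Y}(D,o)$. * A $(D_X,\rho)_Y$-coloring of $D$ is an equivalence class of assignments of a normal orientation and an element of $D_X$ to each semi-sheet, together with an assignment of an element of $Y$ to each complementary region. The conditions at each double point curve are as follows. The labels $x_1,x_2$ of the two upper semi-sheets satisfy $x_1=x_2$ if their normal orientations are coherent and $x_1=\rho(x_2)$ otherwise. If the normal orientation of one of the upper semi-sheets, labelled $x_3$, points from the lower semi-sheet labelled $x_1$ to the one labelled $x_2$, then $x_1\star x_3=x_2$ if the normal orientations of the two lower semi-sheets are coherent, and $x_1\star x_3=\rho(x_2)$ otherwise. If the normal orientation of a semi-sheet labelled $x$ points from a region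 labelled $r_1$ to a region labelled $r_2$, then $r_1\star x=r_2$. The equivalence relation is generated by basic inversions, which at one semi-sheet reverse the normal orientation and replace the label $x$ by $\rho(x)$. * The canonical form of a $(D_X,\rho)_Y$-coloring $C$ is its representative with all semi-sheet labels in $X^{+1}$; its normal orientations define the orientation of $D$ induced by $C$. Two colorings are orientation equivalent if they induce the same orientation; $[C]_{\mathrm{ori}}$ is the class of $C$ among the $(D_X,\rho)_Y$-colorings of $D$. **Theorem.** Let $(D,o)$ be an oriented surface-link diagram and let $C$ be a $(D_X,\rho)_Y$-coloring of $D$ that induces the orientation $o$. Then there is a one-to-one correspondence between $\mathrm{Col}_{X_Y}(D,o)$ and $[C]_{\mathrm{ori}}$, and thus $$\#\,\mathrm{Col}_{X_Y}(D,o)=\#\,[C]_{\mathrm{ori}}.$$ -/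

import Mathlib

open Set Filter Topology
open scoped Quandles MulOpposite

universe u v w

/-! ## Quandles

Mathlib's `y ◃ x` is the product `x * y` of a quandle whose elements act from the right, and
`y ◃⁻¹ x` is `x * y⁻¹`. -/

/-- The associated group `G_X = ⟨x ∈ X | x * y = y⁻¹ x y⟩` of a quandle `X`. -/
def AssocGroup (X : Type v) [Quandle X] : Type v :=
  PresentedGroup {r : FreeGroup X | ∃ x y : X,
    r = (FreeGroup.of (y ◃ x))⁻¹ * ((FreeGroup.of y)⁻¹ * FreeGroup.of x * FreeGroup.of y)}

noncomputable instance (X : Type v) [Quandle X] : Group (AssocGroup X) :=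
  inferInstanceAs (Group (PresentedGroup _))

/-- The canonical map `X → G_X`. -/
def AssocGroup.of {X : Type v} [Quandle X] (x : X) : AssocGroup X :=
  PresentedGroup.of x

theorem AssocGroup.of_act {X : Type v} [Quandle X] (x y : X) :
    AssocGroup.of (y ◃ x) = (AssocGroup.of y)⁻¹ * AssocGroup.of x * AssocGroup.of y := by
  have h := PresentedGroup.one_of_mem (rels := {r : FreeGroup X | ∃ x y : X,
    r = (FreeGroup.of (y ◃ x))⁻¹ * ((FreeGroup.of y)⁻¹ * FreeGroup.of x * FreeGroup.of y)})
    ⟨x, y, rfl⟩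
  simp only [map_mul, map_inv] at h
  exact inv_mul_eq_one.mp h

/-- A symmetric quandle `(X, ρ)`: a quandle with a good involution `ρ`. -/
class SymmetricQuandle (X : Type v) extends Quandle X where
  rho : X → X
  rho_rho : ∀ x, rho (rho x) = x
  /-- `ρ (x * y) = ρ x * y` -/
  rho_act : ∀ x y : X, rho (y ◃ x) = y ◃ rho x
  /-- `x * ρ y = x * y⁻¹` -/
  act_rho : ∀ x y : X, rho y ◃ x = y ◃⁻¹ x

/-- The associated group `G_(X,ρ) = ⟨x ∈ X | x * y = y⁻¹ x y, ρ x = x⁻¹⟩`. -/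
def SymAssocGroup (X : Type v) [SymmetricQuandle X] : Type v :=
  PresentedGroup ({r : FreeGroup X | ∃ x y : X,
    r = (FreeGroup.of (y ◃ x))⁻¹ * ((FreeGroup.of y)⁻¹ * FreeGroup.of x * FreeGroup.of y)} ∪
    {r : FreeGroup X | ∃ x : X, r = FreeGroup.of (SymmetricQuandle.rho x) * FreeGroup.of x})

noncomputable instance (X : Type v) [SymmetricQuandle X] : Group (SymAssocGroup X) :=
  inferInstanceAs (Group (PresentedGroup _))

/-- The canonical map `X → G_(X,ρ)`. -/
def SymAssocGroup.of {X : Type v} [SymmetricQuandle X] (x : X) : SymAssocGroup X :=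
  PresentedGroup.of x

/-- The underlying set `D_X = X⁺¹ ⊔ X⁻¹` of the double of `X`; `⟨x, ε⟩` is `x^ε`. -/
@[ext]
structure QuandleDouble (X : Type v) where
  elt : X
  sign : ℤˣ

namespace QuandleDouble

variable {X : Type v} [Quandle X]

/-- `x * y^δ` for a sign `δ`. -/
def signedAct (δ : ℤˣ) (y x : X) : X :=
  if δ = 1 then y ◃ x else y ◃⁻¹ x

@[simp] theorem signedAct_one (y x : X) : signedAct 1 y x = y ◃ x := by simp [signedAct]

@[simp] theorem signedAct_neg_one (y x : X) : signedAct (-1) y x = y ◃⁻¹ x := by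
  simp [signedAct]

theorem act_invAct (x y z : X) : x ◃ (y ◃⁻¹ z) = (x ◃ y) ◃⁻¹ (x ◃ z) := by
  rw [← Rack.left_cancel (x ◃ y), Rack.act_invAct_eq, ← Shelf.self_distrib, Rack.act_invAct_eq]

theorem invAct_act (x y z : X) : x ◃⁻¹ (y ◃ z) = (x ◃⁻¹ y) ◃ (x ◃⁻¹ z) := by
  rw [← Rack.left_cancel x, Rack.act_invAct_eq, Shelf.self_distrib, Rack.act_invAct_eq,
    Rack.act_invAct_eq]

/-- The double of `X`: `x^ε ⋆ y^δ = (x * y^δ)^ε`, together with `ρ (x^ε) = x^(-ε)`, i.e. the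
symmetric double `(D_X, ρ)`. -/
instance : SymmetricQuandle (QuandleDouble X) where
  act b a := ⟨signedAct b.sign b.elt a.elt, a.sign⟩
  invAct b a := ⟨signedAct (-b.sign) b.elt a.elt, a.sign⟩
  self_distrib := by
    rintro ⟨x, ε⟩ ⟨y, δ⟩ ⟨z, ζ⟩
    rcases Int.units_eq_one_or ε with rfl | rfl <;> rcases Int.units_eq_one_or δ with rfl | rfl <;>
      simp only [signedAct_one, signedAct_neg_one]
    · rw [Shelf.self_distrib]
    · rw [act_invAct]
    · rw [invAct_act]
    · rw [Rack.self_distrib_inv]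
  left_inv := by
    rintro ⟨x, ε⟩ ⟨y, δ⟩
    rcases Int.units_eq_one_or ε with rfl | rfl <;> simp
  right_inv := by
    rintro ⟨x, ε⟩ ⟨y, δ⟩
    rcases Int.units_eq_one_or ε with rfl | rfl <;> simp
  fix := by
    rintro ⟨x, ε⟩
    rcases Int.units_eq_one_or ε with rfl | rfl <;> simp
  rho a := ⟨a.elt, -a.sign⟩
  rho_rho := by rintro ⟨x, ε⟩; simp
  rho_act := by intros; rfl
  act_rho := by intros; rfl

/-- The homomorphism `π : G_(D_X,ρ) → G_X`, `x^ε ↦ x^ε`. -/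
noncomputable def toAssocGroup (X : Type v) [Quandle X] :
    SymAssocGroup (QuandleDouble X) →* AssocGroup X :=
  PresentedGroup.toGroup (f := fun a : QuandleDouble X => AssocGroup.of a.elt ^ (a.sign : ℤ)) <| by
    rintro r (⟨⟨x, ε⟩, ⟨y, δ⟩, rfl⟩ | ⟨⟨x, ε⟩, rfl⟩)
    · have key : AssocGroup.of (signedAct δ y x) =
          (AssocGroup.of y ^ (δ : ℤ))⁻¹ * AssocGroup.of x * AssocGroup.of y ^ (δ : ℤ) := by
        rcases Int.units_eq_one_or δ with rfl | rfl
        · simp [AssocGroup.of_act]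
        · have h := AssocGroup.of_act (y ◃⁻¹ x) y
          rw [Rack.act_invAct_eq] at h
          simp [h, mul_assoc]
      have h2 : ((⟨y, δ⟩ : QuandleDouble X) ◃ ⟨x, ε⟩) = ⟨signedAct δ y x, ε⟩ := rfl
      simp only [h2, map_mul, map_inv, FreeGroup.lift_apply_of, key]
      rcases Int.units_eq_one_or ε with rfl | rfl <;> simp [mul_assoc]
    · have h2 : SymmetricQuandle.rho (⟨x, ε⟩ : QuandleDouble X) = ⟨x, -ε⟩ := rfl
      simp [h2]

/-- An `X`-set `Y` (a right `G_X`-action is a left action of the opposite group) is a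
`(D_X, ρ)`-set by `a ⋆ g = a * π g`. -/
noncomputable instance {Y : Type w} [MulAction (AssocGroup X)ᵐᵒᵖ Y] :
    MulAction (SymAssocGroup (QuandleDouble X))ᵐᵒᵖ Y :=
  MulAction.compHom Y (toAssocGroup X).op

end QuandleDouble

/-! ## Surface-links and their diagrams

Only the topology of `ℝ², ℝ³, ℝ⁴` matters below; `ℝ⁴` is written as `ℝ³ × ℝ`, and the projection
to `ℝ³` is the first projection, the last coordinate being the height. -/

/-- `ℝ²` -/
abbrev Plane : Type := Fin 2 → ℝ

/-- `ℝ³` -/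
abbrev Space : Type := Fin 3 → ℝ

/-- A locally flat embedding in `ℝ⁴` of a closed surface `F` (not necessarily connected).
Orientability is the existence of an `Orientation`, see below. -/
structure SurfaceLink (F : Type u) [TopologicalSpace F] [T2Space F] [CompactSpace F]
    [ChartedSpace (EuclideanSpace ℝ (Fin 2)) F] where
  emb : F → Space × ℝ
  isEmbedding : IsEmbedding emb
  locallyFlat : ∀ p : F, ∃ Φ : OpenPartialHomeomorph (Space × ℝ) (Fin 4 → ℝ),
    emb p ∈ Φ.source ∧ ∀ y ∈ Φ.source, (y ∈ range emb ↔ Φ y 2 = 0 ∧ Φ y 3 = 0)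

namespace SurfaceLink

variable {F : Type u} [TopologicalSpace F] [T2Space F] [CompactSpace F]
  [ChartedSpace (EuclideanSpace ℝ (Fin 2)) F]

/-- The projection of the surface to `ℝ³`. -/
def proj (L : SurfaceLink F) (p : F) : Space := (L.emb p).1

/-- The height of a point of the surface. -/
def height (L : SurfaceLink F) (p : F) : ℝ := (L.emb p).2

theorem continuous_proj (L : SurfaceLink F) : Continuous L.proj :=
  continuous_fst.comp L.isEmbedding.continuous

/-- One coordinate plane: the model of the projection at a point of multiplicity one. -/
def regularModel : Fin 1 → Plane → Space := fun _ a => ![a 0, a 1, 0]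

/-- The two coordinate planes `x = 0` and `y = 0`. -/
def doubleModel : Fin 2 → Plane → Space
  | 0, a => ![0, a 0, a 1]
  | 1, a => ![a 0, 0, a 1]

/-- The three coordinate planes `x = 0`, `y = 0`, `z = 0`. -/
def tripleModel : Fin 3 → Plane → Space
  | 0, a => ![0, a 0, a 1]
  | 1, a => ![a 0, 0, a 1]
  | 2, a => ![a 0, a 1, 0]

/-- The Whitney umbrella. -/
def branchModel : Fin 1 → Plane → Space := fun _ a => ![a 0 * a 1, a 0, a 1 ^ 2]

/-- A coordinate neighbourhood `φ.source ≅ ℝ³` whose preimage in the surface is a disjoint union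
of `k` open discs, parametrized by `ψ i`, on which the projection is the model map `m i`. -/
structure LocalChart (L : SurfaceLink F) {k : ℕ} (m : Fin k → Plane → Space) where
  φ : OpenPartialHomeomorph Space Space
  ψ : Fin k → Plane → F
  target_eq : φ.target = univ
  isOpenEmbedding : ∀ i, IsOpenEmbedding (ψ i)
  disjoint : ∀ i j, i ≠ j → Disjoint (range (ψ i)) (range (ψ j))
  preimage_eq : L.proj ⁻¹' φ.source = ⋃ i, range (ψ i)
  map_eq : ∀ i a, φ (L.proj (ψ i a)) = m i a

/-- A chart around a part of a double point curve: the sheet `x = 0` (index `0`) is the upper one,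
the sheet `y = 0` (index `1`) is the lower one. -/
structure DoubleChart (L : SurfaceLink F) extends LocalChart L doubleModel where
  height_lt : ∀ t : ℝ, L.height (ψ 1 ![0, t]) < L.height (ψ 0 ![0, t])

/-- A chart around a triple point: top sheet `x = 0`, middle sheet `y = 0`, bottom sheet `z = 0`. -/
structure TripleChart (L : SurfaceLink F) extends LocalChart L tripleModel where
  top_middle : ∀ t : ℝ, L.height (ψ 1 ![0, t]) < L.height (ψ 0 ![0, t])
  top_bottom : ∀ t : ℝ, L.height (ψ 2 ![0, t]) < L.height (ψ 0 ![t, 0])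
  middle_bottom : ∀ t : ℝ, L.height (ψ 2 ![t, 0]) < L.height (ψ 1 ![t, 0])

/-- The chart is centred at the point `q`. -/
def LocalChart.CentredAt {L : SurfaceLink F} {k : ℕ} {m : Fin k → Plane → Space}
    (c : LocalChart L m) (q : Space) : Prop :=
  q ∈ c.φ.source ∧ c.φ q = 0

/-- The projection is generic: every point of the image has a neighbourhood in which the image
is an embedded sheet, two or three sheets crossing transversely, or a branch point. -/
def IsGeneric (L : SurfaceLink F) : Prop :=
  ∀ p : F,
    (∃ c : LocalChart L regularModel, c.CentredAt (L.proj p)) ∨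
    (∃ c : DoubleChart L, c.CentredAt (L.proj p)) ∨
    (∃ c : TripleChart L, c.CentredAt (L.proj p)) ∨
    (∃ c : LocalChart L branchModel, c.CentredAt (L.proj p))

/-- The points of the surface that project to multiple points. -/
def doubleSet (L : SurfaceLink F) : Set F :=
  {p | ∃ p', p' ≠ p ∧ L.proj p' = L.proj p}

/-- The points of the surface that lie below another point. -/
def lowerSet (L : SurfaceLink F) : Set F :=
  {p | ∃ p', L.proj p' = L.proj p ∧ L.height p < L.height p'}

theorem lowerSet_subset (L : SurfaceLink F) : L.lowerSet ⊆ L.doubleSet := by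
  rintro p ⟨p', h, hlt⟩
  exact ⟨p', by rintro rfl; exact lt_irrefl _ hlt, h⟩

/-- The sheets: the components left after removing the lower double point curves. The closure only
adds the branch points, which also belong to a regular neighbourhood of these curves. -/
def Sheet (L : SurfaceLink F) : Type u :=
  ConnectedComponents {p : F // p ∉ closure L.lowerSet}

/-- The semi-sheets: the components left after removing all double point curves. -/
def SemiSheet (L : SurfaceLink F) : Type u :=
  ConnectedComponents {p : F // p ∉ closure L.doubleSet}

/-- The complementary regions of the diagram in `ℝ³`. -/
def Region (L : SurfaceLink F) : Type :=
  ConnectedComponents {y : Space // y ∉ range L.proj}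

/-- The sheet through a point. -/
def sheetAt (L : SurfaceLink F) (p : F) (hp : p ∉ closure L.lowerSet) : L.Sheet :=
  ConnectedComponents.mk (⟨p, hp⟩ : {p : F // p ∉ closure L.lowerSet})

/-- The semi-sheet through a point. -/
def semiSheetAt (L : SurfaceLink F) (p : F) (hp : p ∉ closure L.doubleSet) : L.SemiSheet :=
  ConnectedComponents.mk (⟨p, hp⟩ : {p : F // p ∉ closure L.doubleSet})

/-- A semi-sheet as a subset of the surface. -/
def SemiSheet.carrier {L : SurfaceLink F} (s : L.SemiSheet) : Set F :=
  {p | ∃ hp : p ∉ closure L.doubleSet, L.semiSheetAt p hp = s}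

/-- A complementary region as a subset of `ℝ³`. -/
def Region.carrier {L : SurfaceLink F} (γ : L.Region) : Set Space :=
  {y | ∃ hy : y ∉ range L.proj,
    ConnectedComponents.mk (⟨y, hy⟩ : {y : Space // y ∉ range L.proj}) = γ}

/-- The sheet that contains a given semi-sheet. -/
def SemiSheet.sheet {L : SurfaceLink F} : L.SemiSheet → L.Sheet :=
  Continuous.connectedComponentsMap
    (f := fun p : {p : F // p ∉ closure L.doubleSet} =>
      (⟨p.1, fun h => p.2 (closure_mono L.lowerSet_subset h)⟩ : {p : F // p ∉ closure L.lowerSet}))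
    (by fun_prop)

/-! ### Normal orientations -/

/-- A chart of `ℝ³` in which a disc of the surface is mapped to the plane `z = 0`. -/
structure FlatChart (L : SurfaceLink F) where
  φ : OpenPartialHomeomorph Space Space
  ψ : Plane → F
  isOpenEmbedding : IsOpenEmbedding ψ
  mem_source : ∀ a, L.proj (ψ a) ∈ φ.source
  map_eq : ∀ a, φ (L.proj (ψ a)) = ![a 0, a 1, 0]

/-- The side `z > 0` of the disc at `p`, as the filter of one-sided neighbourhoods. -/
def FlatChart.posSide {L : SurfaceLink F} (κ : FlatChart L) (p : F) : Filter Space :=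
  𝓝[{y | y ∈ κ.φ.source ∧ 0 < κ.φ y 2}] (L.proj p)

/-- The side `z < 0` of the disc at `p`. -/
def FlatChart.negSide {L : SurfaceLink F} (κ : FlatChart L) (p : F) : Filter Space :=
  𝓝[{y | y ∈ κ.φ.source ∧ κ.φ y 2 < 0}] (L.proj p)

/-- A normal orientation on a subset `S` of the surface: a continuous choice, at each point of
`S`, of one of the two sides of the surface in `ℝ³`, the side to which it points. -/
structure NormalOrientation (L : SurfaceLink F) (S : Set F) where
  side : S → Filter Space
  locally_const : ∀ p : S, ∃ κ : FlatChart L, ∀ᶠ p' : S in 𝓝 p,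
    p'.1 ∈ range κ.ψ ∧ side p' = κ.posSide p'.1

/-- The two normal orientations are opposite to each other. -/
def NormalOrientation.IsOpposite {L : SurfaceLink F} {S : Set F}
    (n n' : NormalOrientation L S) : Prop :=
  ∀ p : S, ∃ κ : FlatChart L,
    p.1 ∈ range κ.ψ ∧ n.side p = κ.posSide p.1 ∧ n'.side p = κ.negSide p.1

/-- The points at which the projection is locally flat, i.e. all but the branch points. -/
def immersedSet (L : SurfaceLink F) : Set F :=
  {p | ∃ κ : FlatChart L, p ∈ range κ.ψ}

/-- An orientation `o = (o₁, o₂)` of the diagram, represented by the normal orientation `n` for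
which `(o₁, o₂, n)` is right-handed. It is defined, and continuous, at all points of the surface
but the branch points (in particular across the double point curves and at triple points); there
the surface has no sides, and its orientation is determined by that around them. -/
abbrev Orientation (L : SurfaceLink F) : Type u :=
  NormalOrientation L L.immersedSet

/-- A side `ℓ` of the surface at `p`, understood as a normal direction, points from the
complementary region `γ₁` to the complementary region `γ₂`. -/
def PointsFrom (L : SurfaceLink F) (p : F) (ℓ : Filter Space) (γ₁ γ₂ : L.Region) : Prop :=
  ∃ κ : FlatChart L, p ∈ range κ.ψ ∧ ℓ = κ.posSide p ∧
    κ.negSide p ≤ 𝓟 γ₁.carrier ∧ κ.posSide p ≤ 𝓟 γ₂.carrier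

/-! ### Sheets and semi-sheets around a double point curve -/

namespace DoubleChart

variable {L : SurfaceLink F}

/-- The side of the sheet `i` at `ψ i a` to which the `i`-th coordinate axis of the chart points
(for `ε = 1`) or from which it points (for `ε = -1`). -/
def side (χ : DoubleChart L) (i : Fin 2) (a : Plane) (ε : ℤˣ) : Filter Space :=
  𝓝[{y | y ∈ χ.φ.source ∧ 0 < ((ε : ℤ) : ℝ) * χ.φ y i.castSucc}] (L.proj (χ.ψ i a))

theorem eq_of_proj_eq (χ : DoubleChart L) {i : Fin 2} {a : Plane} {p : F}
    (h : L.proj p = L.proj (χ.ψ i a)) :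
    p = χ.ψ i a ∨ (a 0 = 0 ∧ ∃ j, j ≠ i ∧ p = χ.ψ j a) := by
  have hmem : χ.ψ i a ∈ L.proj ⁻¹' χ.φ.source := by
    rw [χ.preimage_eq]; exact mem_iUnion.2 ⟨i, a, rfl⟩
  have hp : p ∈ L.proj ⁻¹' χ.φ.source := by
    rw [mem_preimage, h]; exact hmem
  rw [χ.preimage_eq] at hp
  obtain ⟨j, b, rfl⟩ := mem_iUnion.1 hp
  have hm : doubleModel j b = doubleModel i a := by rw [← χ.map_eq, ← χ.map_eq, h]
  have h0 := congrFun hm 0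
  have h1 := congrFun hm 1
  have h2 := congrFun hm 2
  have ext2 : b 0 = a 0 → b 1 = a 1 → b = a := fun e0 e1 => by
    funext k; fin_cases k <;> simpa
  fin_cases i <;> fin_cases j <;> simp [doubleModel] at h0 h1 h2
  · left; rw [ext2 h1 h2]
  · right
    exact ⟨h1.symm, 1, by simp, by rw [ext2 (h0.trans h1) h2]; rfl⟩
  · right
    exact ⟨h0.symm, 0, by simp, by rw [ext2 (h1.trans h0) h2]; rfl⟩
  · left; rw [ext2 h0 h2]

/-- In a double point chart, the points off the curve are not in the closure of the curve. -/
theorem notMem_closure_doubleSet (χ : DoubleChart L) (i : Fin 2) {a : Plane} (ha : a 0 ≠ 0) :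
    χ.ψ i a ∉ closure L.doubleSet := by
  have hopen : IsOpen (χ.ψ i '' {a : Plane | a 0 ≠ 0}) :=
    (χ.isOpenEmbedding i).isOpenMap _ (isOpen_ne_fun (continuous_apply 0) continuous_const)
  intro hcl
  obtain ⟨p, ⟨b, hb, rfl⟩, p', hne, hp'⟩ :=
    mem_closure_iff.1 hcl _ hopen (mem_image_of_mem _ ha)
  rcases χ.eq_of_proj_eq hp' with h | ⟨h, -⟩
  · exact hne h
  · exact hb h

/-- In a double point chart, the upper sheet is disjoint from the lower double points. -/
theorem notMem_closure_lowerSet (χ : DoubleChart L) (a : Plane) :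
    χ.ψ 0 a ∉ closure L.lowerSet := by
  intro hcl
  obtain ⟨p, ⟨b, rfl⟩, p', hp', hlt⟩ :=
    mem_closure_iff.1 hcl _ (χ.isOpenEmbedding 0).isOpen_range (mem_range_self a)
  rcases χ.eq_of_proj_eq hp' with rfl | ⟨h, j, hj, rfl⟩
  · exact lt_irrefl _ hlt
  · obtain rfl : j = 1 := by omega
    have hb : b = ![0, b 1] := by funext k; fin_cases k <;> simp [h]
    rw [hb] at hlt
    exact lt_asymm hlt (χ.height_lt _)

/-- Base points of the two halves of the sheet `i`. -/
def base (ε : ℤˣ) : Plane := ![((ε : ℤ) : ℝ), 0]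

theorem base_ne (ε : ℤˣ) : base ε 0 ≠ 0 := by
  simp [base]

/-- The semi-sheet at the double point curve that is the part `a 0 > 0` (for `ε = 1`) or `a 0 < 0`
(for `ε = -1`) of the upper (`i = 0`) or lower (`i = 1`) sheet. For the lower sheet these are the
sides `x > 0` and `x < 0` of the upper sheet `x = 0`. -/
def semiSheet (χ : DoubleChart L) (i : Fin 2) (ε : ℤˣ) : L.SemiSheet :=
  L.semiSheetAt (χ.ψ i (base ε)) (χ.notMem_closure_doubleSet i (base_ne ε))

theorem mem_semiSheet (χ : DoubleChart L) (i : Fin 2) (ε : ℤˣ) :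
    χ.ψ i (base ε) ∈ (χ.semiSheet i ε).carrier :=
  ⟨χ.notMem_closure_doubleSet i (base_ne ε), rfl⟩

/-- The upper sheet at the double point curve. -/
def overSheet (χ : DoubleChart L) : L.Sheet :=
  L.sheetAt (χ.ψ 0 0) (χ.notMem_closure_lowerSet 0)

end DoubleChart

/-! ### Colorings by quandles -/

section Quandle

variable (L : SurfaceLink F) (X : Type v) [Quandle X] (Y : Type w) [MulAction (AssocGroup X)ᵐᵒᵖ Y]

/-- The condition for `X`-colorings of `(D, o)`: if the normal orientation of the upper sheet,
labelled `x₃`, points from the lower sheet labelled `x₁` to the one labelled `x₂`, then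
`x₁ * x₃ = x₂`. -/
def IsColoring (o : L.Orientation) (c : L.Sheet → X) : Prop :=
  ∀ (χ : DoubleChart L) (ε : ℤˣ) (p : L.immersedSet), p.1 = χ.ψ 0 0 → o.side p = χ.side 0 0 ε →
    c χ.overSheet ◃ c (χ.semiSheet 1 (-ε)).sheet = c (χ.semiSheet 1 ε).sheet

/-- The set `Col_{X_Y}(D, o)` of `X_Y`-colorings: an `X`-coloring with a label in `Y` for each
complementary region such that `r₁ * x = r₂` when the normal orientation of a semi-sheet in a sheet
labelled `x` points from the region labelled `r₁` to the one labelled `r₂`. -/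
structure ShadowColoring (o : L.Orientation) where
  color : L.Sheet → X
  isColoring : L.IsColoring X o color
  region : L.Region → Y
  region_cond : ∀ (s : L.SemiSheet) (p : L.immersedSet) (γ₁ γ₂ : L.Region), p.1 ∈ s.carrier →
    L.PointsFrom p.1 (o.side p) γ₁ γ₂ →
      MulOpposite.op (AssocGroup.of (color s.sheet)) • region γ₁ = region γ₂

end Quandle

/-! ### Colorings by symmetric quandles -/

section SymmetricQuandle

variable (L : SurfaceLink F) (X : Type v) [SymmetricQuandle X]
  (Y : Type w) [MulAction (SymAssocGroup X)ᵐᵒᵖ Y]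

/-- An assignment of a normal orientation and an element of `X` to each semi-sheet. -/
@[ext]
structure Assignment where
  normal : ∀ s : L.SemiSheet, NormalOrientation L s.carrier
  label : L.SemiSheet → X

variable {L X}

/-- The normal orientation of the half `δ` of the sheet `i` at a double point curve points to
the side `ε`. -/
def Assignment.Directed (A : Assignment L X) (χ : DoubleChart L) (i : Fin 2) (δ ε : ℤˣ) : Prop :=
  (A.normal (χ.semiSheet i δ)).side ⟨_, χ.mem_semiSheet i δ⟩ = χ.side i (DoubleChart.base δ) ε

/-- The normal orientations of the two halves of the sheet `i` at a double point curve are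
coherent: they point to the same side of the sheet. -/
def Assignment.Coherent (A : Assignment L X) (χ : DoubleChart L) (i : Fin 2) : Prop :=
  ∃ ε : ℤˣ, A.Directed χ i 1 ε ∧ A.Directed χ i (-1) ε

/-- The conditions for `(X, ρ)`-colorings. `over`: the labels `x₁, x₂` of the two upper semi-sheets
satisfy `x₁ = x₂` if their normal orientations are coherent and `x₁ = ρ x₂` otherwise. `under`: if
the normal orientation of one of the upper semi-sheets, labelled `x₃`, points from the lower
semi-sheet labelled `x₁` to the one labelled `x₂`, then `x₁ * x₃ = x₂` if the normal orientations
of the two lower semi-sheets are coherent and `x₁ * x₃ = ρ x₂` otherwise. -/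
structure Assignment.IsValid (A : Assignment L X) : Prop where
  over_coherent : ∀ χ : DoubleChart L, A.Coherent χ 0 →
    A.label (χ.semiSheet 0 1) = A.label (χ.semiSheet 0 (-1))
  over_incoherent : ∀ χ : DoubleChart L, ¬ A.Coherent χ 0 →
    A.label (χ.semiSheet 0 1) = SymmetricQuandle.rho (A.label (χ.semiSheet 0 (-1)))
  under_coherent : ∀ (χ : DoubleChart L) (δ ε : ℤˣ), A.Directed χ 0 δ ε → A.Coherent χ 1 →
    A.label (χ.semiSheet 0 δ) ◃ A.label (χ.semiSheet 1 (-ε)) = A.label (χ.semiSheet 1 ε)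
  under_incoherent : ∀ (χ : DoubleChart L) (δ ε : ℤˣ), A.Directed χ 0 δ ε → ¬ A.Coherent χ 1 →
    A.label (χ.semiSheet 0 δ) ◃ A.label (χ.semiSheet 1 (-ε)) =
      SymmetricQuandle.rho (A.label (χ.semiSheet 1 ε))

/-- A basic inversion: at one semi-sheet, the normal orientation is replaced by the opposite one
and the label `x` by `ρ x`. -/
def BasicInversion (A B : {A : Assignment L X // A.IsValid}) : Prop :=
  ∃ s : L.SemiSheet,
    (A.1.normal s).IsOpposite (B.1.normal s) ∧
    B.1.label s = SymmetricQuandle.rho (A.1.label s) ∧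
    ∀ t, t ≠ s → B.1.normal t = A.1.normal t ∧ B.1.label t = A.1.label t

variable (L X)

/-- The set `Col_{(X,ρ)}(D)`: classes of assignments under the equivalence relation generated by
basic inversions. -/
def SymColoring : Type (max u v) :=
  Quot (BasicInversion (L := L) (X := X))

/-- The set `Col_{(X,ρ)_Y}(D)`: an `(X, ρ)`-coloring with a label in `Y` for each complementary
region such that `r₁ * x = r₂` when the normal orientation of a semi-sheet labelled `x` points
from the region labelled `r₁` to the one labelled `r₂`. -/
structure SymShadowColoring where
  color : L.SymColoring X
  region : L.Region → Y
  region_cond : ∀ A : {A : Assignment L X // A.IsValid},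
    Quot.mk _ A = color → ∀ (s : L.SemiSheet) (p : s.carrier) (γ₁ γ₂ : L.Region),
      L.PointsFrom p.1 ((A.1.normal s).side p) γ₁ γ₂ →
        MulOpposite.op (SymAssocGroup.of (A.1.label s)) • region γ₁ = region γ₂

end SymmetricQuandle

/-! ### Orientations induced by colorings by the symmetric double -/

section Double

variable {L : SurfaceLink F} {X : Type v} [Quandle X] {Y : Type w} [MulAction (AssocGroup X)ᵐᵒᵖ Y]

/-- `A` is the canonical form of the `(D_X, ρ)`-coloring `c`: the representative with all labels
in `X⁺¹`. -/
def IsCanonicalForm (c : L.SymColoring (QuandleDouble X))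
    (A : {A : Assignment L (QuandleDouble X) // A.IsValid}) : Prop :=
  Quot.mk _ A = c ∧ ∀ s, (A.1.label s).sign = 1

/-- `o` is the orientation of `D` induced by the canonical form of the `(D_X, ρ)_Y`-coloring `C`,
i.e. `(D, o)` is the image of `(D, C)` under the transformation map. -/
def SymShadowColoring.Induces (C : L.SymShadowColoring (QuandleDouble X) Y)
    (o : L.Orientation) : Prop :=
  ∃ A, IsCanonicalForm C.color A ∧
    ∀ (s : L.SemiSheet) (p : F) (hs : p ∈ s.carrier) (hi : p ∈ L.immersedSet),
      o.side ⟨p, hi⟩ = (A.1.normal s).side ⟨p, hs⟩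

/-- Orientation equivalence: the orientations induced by the canonical forms coincide. -/
def SymShadowColoring.OriEquiv (C C' : L.SymShadowColoring (QuandleDouble X) Y) : Prop :=
  ∀ o : L.Orientation, C.Induces o ↔ C'.Induces o

/-- The orientation equivalence class `[C]_ori`. -/
def SymShadowColoring.oriClass (C : L.SymShadowColoring (QuandleDouble X) Y) :
    Set (L.SymShadowColoring (QuandleDouble X) Y) :=
  {C' | C.OriEquiv C'}

end Double

end SurfaceLink

/-- A surface-link diagram: a surface-link in `ℝ³ × ℝ` whose projection to `ℝ³` is generic. -/
structure SurfaceLinkDiagram (F : Type u) [TopologicalSpace F] [T2Space F] [CompactSpace F]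
    [ChartedSpace (EuclideanSpace ℝ (Fin 2)) F] extends SurfaceLink F where
  generic : toSurfaceLink.IsGeneric

/-! A class of assignments has at most one canonical form. Equivalent assignments agree at each
semi-sheet or differ there by a single inversion (`Assignment.inversionEquiv_of_eq`), and an
inversion changes the sign of a label of the double. If a coloring induces `o`, the normal
orientations of its canonical form are the restrictions of `o`, so only the labels `x^{+1}` and the
region labels remain free. For the same reason, being orientation equivalent to `C` amounts to
inducing `o`.

Since `o` is continuous across the double point curves, all pairs of semi-sheets are coherent there.
The over condition then says that labels agree across a curve in the upper sheet, so they descend to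
the sheets (`IsGeneric.exists_sheet_factor`), and the under condition becomes the quandle condition.
The region condition at the canonical form is that of an `X_Y`-coloring; it passes to the other
representatives because an inversion swaps the two regions and inverts the acting element.

Two topological facts carry this. Off the branch points the surface has exactly two local sides,
independently of the chart (`FlatChart.sameSides_or_flip`); hence a double inversion is trivial, and
an orientation points to one side of each disc. And a function on semi-sheets that agrees across
every double point curve in an upper sheet is constant on sheets (`IsGeneric.eq_of_sheet_eq`); here
genericity is used, the delicate case being the top sheet at a triple point. -/

namespace SurfaceLink

variable {F : Type u} [TopologicalSpace F] [T2Space F] [CompactSpace F]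
  [ChartedSpace (EuclideanSpace ℝ (Fin 2)) F] {L : SurfaceLink F}

/-! ### The two sides of the surface -/

namespace FlatChart

/-- The reflection of `ℝ³` in the plane `z = 0`. -/
def reflection : Space ≃ₜ Space where
  toFun y := ![y 0, y 1, -y 2]
  invFun y := ![y 0, y 1, -y 2]
  left_inv y := by funext k; fin_cases k <;> simp
  right_inv y := by funext k; fin_cases k <;> simp
  continuous_toFun := by fun_prop
  continuous_invFun := by fun_prop

/-- The flat chart with the two sides of the disc interchanged. -/
def flip (κ : FlatChart L) : FlatChart L where
  φ := κ.φ.trans reflection.toOpenPartialHomeomorph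
  ψ := κ.ψ
  isOpenEmbedding := κ.isOpenEmbedding
  mem_source a := by simpa using κ.mem_source a
  map_eq a := by simp [κ.map_eq, reflection]

@[simp] theorem flip_source (κ : FlatChart L) : κ.flip.φ.source = κ.φ.source := by simp [flip]

@[simp] theorem flip_apply (κ : FlatChart L) (y : Space) : κ.flip.φ y 2 = -κ.φ y 2 := by
  simp [flip, reflection]

@[simp] theorem flip_posSide (κ : FlatChart L) (p : F) : κ.flip.posSide p = κ.negSide p := by
  simp [posSide, negSide]

@[simp] theorem flip_negSide (κ : FlatChart L) (p : F) : κ.flip.negSide p = κ.posSide p := by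
  simp [posSide, negSide]

theorem proj_mem_source (κ : FlatChart L) {p : F} (hp : p ∈ range κ.ψ) :
    L.proj p ∈ κ.φ.source := by
  obtain ⟨a, rfl⟩ := hp
  exact κ.mem_source a

theorem apply_proj (κ : FlatChart L) {p : F} (hp : p ∈ range κ.ψ) : κ.φ (L.proj p) 2 = 0 := by
  obtain ⟨a, rfl⟩ := hp
  simp [κ.map_eq]

theorem eventually_source (κ : FlatChart L) {p : F} (hp : p ∈ range κ.ψ) :
    ∀ᶠ y in 𝓝 (L.proj p), y ∈ κ.φ.source :=
  κ.φ.open_source.mem_nhds (κ.proj_mem_source hp)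

/-- Near `p` the points with `z = 0` are projections of points in a given neighbourhood of `p`. -/
theorem eventually_exists_of_eq_zero (κ : FlatChart L) {p : F} (hp : p ∈ range κ.ψ) {U : Set F}
    (hU : U ∈ 𝓝 p) :
    ∀ᶠ y in 𝓝 (L.proj p), κ.φ y 2 = 0 → ∃ p' ∈ U, L.proj p' = y := by
  obtain ⟨a, rfl⟩ := hp
  have hφ : ContinuousAt κ.φ (L.proj (κ.ψ a)) := κ.φ.continuousAt (κ.mem_source a)
  have h0 : ContinuousAt (fun y => κ.φ y 0) (L.proj (κ.ψ a)) :=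
    (continuous_apply 0).continuousAt.comp hφ
  have h1 : ContinuousAt (fun y => κ.φ y 1) (L.proj (κ.ψ a)) :=
    (continuous_apply 1).continuousAt.comp hφ
  have hg : ContinuousAt (fun y => (![κ.φ y 0, κ.φ y 1] : Plane)) (L.proj (κ.ψ a)) := by
    refine continuousAt_pi.2 fun k => ?_
    fin_cases k
    · exact h0
    · exact h1
  have ha : (![κ.φ (L.proj (κ.ψ a)) 0, κ.φ (L.proj (κ.ψ a)) 1] : Plane) = a := by
    funext k; fin_cases k <;> simp [κ.map_eq]
  have hc : Tendsto (fun y => κ.ψ ![κ.φ y 0, κ.φ y 1]) (𝓝 (L.proj (κ.ψ a))) (𝓝 (κ.ψ a)) := by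
    have := (κ.isOpenEmbedding.continuous.tendsto _).comp hg.tendsto
    rwa [ha] at this
  filter_upwards [hc hU, κ.eventually_source (mem_range_self a)] with y hyU hy hz
  refine ⟨_, hyU, κ.φ.injOn (κ.mem_source _) hy ?_⟩
  rw [κ.map_eq]
  funext k; fin_cases k <;> simp [hz]

/-- Near the projection of `p` both zero sets consist of projections of points of the surface near
`p`, and such points lie in both discs. -/
theorem eventually_eq_zero_iff (κ κ' : FlatChart L) {p : F} (hp : p ∈ range κ.ψ)
    (hp' : p ∈ range κ'.ψ) :
    ∀ᶠ y in 𝓝 (L.proj p), κ.φ y 2 = 0 ↔ κ'.φ y 2 = 0 := by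
  filter_upwards [κ.eventually_exists_of_eq_zero hp (κ'.isOpenEmbedding.isOpen_range.mem_nhds hp'),
    κ'.eventually_exists_of_eq_zero hp' (κ.isOpenEmbedding.isOpen_range.mem_nhds hp)] with y h h'
  constructor
  · intro hz
    obtain ⟨q, hq, rfl⟩ := h hz
    exact κ'.apply_proj hq
  · intro hz
    obtain ⟨q, hq, rfl⟩ := h' hz
    exact κ.apply_proj hq

theorem frequently_pos (κ : FlatChart L) {p : F} (hp : p ∈ range κ.ψ) :
    ∃ᶠ y in 𝓝 (L.proj p), y ∈ κ.φ.source ∧ 0 < κ.φ y 2 := by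
  have hs := κ.proj_mem_source hp
  have ht := κ.φ.map_source hs
  have hc : Tendsto (fun t : ℝ => κ.φ (L.proj p) + t • (Pi.single 2 1 : Space)) (𝓝 0)
      (𝓝 (κ.φ (L.proj p))) := by
    have : Continuous (fun t : ℝ => κ.φ (L.proj p) + t • (Pi.single 2 1 : Space)) := by fun_prop
    simpa using this.tendsto 0
  have hsymm : Tendsto (fun t : ℝ => κ.φ.symm (κ.φ (L.proj p) + t • (Pi.single 2 1 : Space)))
      (𝓝[>] 0) (𝓝 (L.proj p)) := by
    have := (κ.φ.continuousAt_symm ht).tendsto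
    rw [κ.φ.left_inv hs] at this
    exact (this.comp hc).mono_left nhdsWithin_le_nhds
  refine hsymm.frequently (Eventually.frequently ?_)
  filter_upwards [self_mem_nhdsWithin,
    nhdsWithin_le_nhds (hc (κ.φ.open_target.mem_nhds ht))] with t ht0 htt
  refine ⟨κ.φ.map_target htt, ?_⟩
  rw [κ.φ.right_inv htt]
  simpa [κ.apply_proj hp] using ht0

theorem frequently_neg (κ : FlatChart L) {p : F} (hp : p ∈ range κ.ψ) :
    ∃ᶠ y in 𝓝 (L.proj p), y ∈ κ.φ.source ∧ κ.φ y 2 < 0 := by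
  simpa using κ.flip.frequently_pos (p := p) hp

/-- Two flat charts at `p` have the same positive and the same negative side. -/
def SameSides (κ κ' : FlatChart L) (p : F) : Prop :=
  ∀ᶠ y in 𝓝 (L.proj p), (y ∈ κ.φ.source ∧ y ∈ κ'.φ.source) ∧
    (0 < κ.φ y 2 ↔ 0 < κ'.φ y 2) ∧ (κ.φ y 2 < 0 ↔ κ'.φ y 2 < 0)

theorem _root_.sign_const_of_isPreconnected {α : Type*} [TopologicalSpace α] {S : Set α}
    (hS : IsPreconnected S) {h : α → ℝ} (hc : ContinuousOn h S) (h0 : ∀ v ∈ S, h v ≠ 0) {v : α}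
    (hv : v ∈ S) (hpos : 0 < h v) : ∀ w ∈ S, 0 < h w := by
  intro w hw
  by_contra hn
  obtain ⟨x, hx, hx0⟩ := hS.intermediate_value hw hv hc ⟨not_lt.1 hn, hpos.le⟩
  exact h0 x hx hx0

/-- Seen in `κ`, the plane `z = 0` cuts a small ball into two convex halves. The height coordinate
of `κ'` vanishes only on that plane, so it has a constant sign on each half; both signs occur near
`p`, so the halves receive different signs. -/
theorem sameSides_or_flip (κ κ' : FlatChart L) {p : F} (hp : p ∈ range κ.ψ)
    (hp' : p ∈ range κ'.ψ) : SameSides κ κ' p ∨ SameSides κ κ'.flip p := by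
  have hs := κ.proj_mem_source hp
  have hev := (κ.eventually_source hp).and
    ((κ'.eventually_source hp').and (κ.eventually_eq_zero_iff κ' hp hp'))
  have hev' : ∀ᶠ x in 𝓝 (κ.φ (L.proj p)), x ∈ κ.φ.target ∧ κ.φ.symm x ∈ κ'.φ.source ∧
      (x 2 = 0 ↔ κ'.φ (κ.φ.symm x) 2 = 0) := by
    have ht := κ.φ.map_source hs
    have h1 := (κ.φ.continuousAt_symm ht).tendsto
    rw [κ.φ.left_inv hs] at h1
    filter_upwards [h1.eventually hev, κ.φ.open_target.mem_nhds ht] with x hx hxt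
    refine ⟨hxt, hx.2.1, ?_⟩
    simpa [κ.φ.right_inv hxt] using hx.2.2
  obtain ⟨r, hr, hB⟩ := Metric.eventually_nhds_iff_ball.1 hev'
  set B := Metric.ball (κ.φ (L.proj p)) r with hBdef
  set h : Space → ℝ := fun x => κ'.φ (κ.φ.symm x) 2 with hh
  have hcont : ContinuousOn h B := by
    have h1 : ContinuousOn κ.φ.symm B := κ.φ.continuousOn_symm.mono fun x hx => (hB x hx).1
    have h2 : ContinuousOn (fun x => κ'.φ (κ.φ.symm x)) B :=
      κ'.φ.continuousOn.comp h1 fun x hx => (hB x hx).2.1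
    exact (continuous_apply 2).comp_continuousOn h2
  have hconv : Convex ℝ B := convex_ball _ _
  have hlin : IsLinearMap ℝ (fun x : Space => x 2) := ⟨fun _ _ => rfl, fun _ _ => rfl⟩
  have hpos : IsPreconnected (B ∩ {x : Space | 0 < x 2}) :=
    (hconv.inter (convex_halfSpace_gt hlin 0)).isPreconnected
  have hneg : IsPreconnected (B ∩ {x : Space | x 2 < 0}) :=
    (hconv.inter (convex_halfSpace_lt hlin 0)).isPreconnected
  have hne : ∀ x ∈ B, x 2 ≠ 0 → h x ≠ 0 := fun x hx hx0 h0 => hx0 ((hB x hx).2.2.2 h0)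
  have hevB : ∀ᶠ y in 𝓝 (L.proj p), κ.φ y ∈ B :=
    (κ.φ.continuousAt hs).tendsto (Metric.ball_mem_nhds _ hr)
  -- Pulls a comparison of signs on the ball back to `ℝ³`; it is applied to `κ'` and to `κ'.flip`,
  -- which have the same source.
  have conclude : ∀ κ₁ : FlatChart L, κ₁.φ.source = κ'.φ.source →
      (∀ x ∈ B, 0 < x 2 → 0 < κ₁.φ (κ.φ.symm x) 2) →
      (∀ x ∈ B, x 2 < 0 → κ₁.φ (κ.φ.symm x) 2 < 0) →
      (∀ x ∈ B, x 2 = 0 → κ₁.φ (κ.φ.symm x) 2 = 0) → SameSides κ κ₁ p := by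
    intro κ₁ hsrc h1 h2 h3
    filter_upwards [hevB, hev] with y hyB hy
    have e := κ.φ.left_inv hy.1
    have h1' := h1 _ hyB
    have h2' := h2 _ hyB
    have h3' := h3 _ hyB
    rw [e] at h1' h2' h3'
    refine ⟨⟨hy.1, hsrc ▸ hy.2.1⟩, ?_⟩
    rcases lt_trichotomy (κ.φ y 2) 0 with hlt | heq | hgt
    · have := h2' hlt
      exact ⟨by constructor <;> intro <;> linarith, by simp [hlt, this]⟩
    · have := h3' heq
      simp [heq, this]
    · have := h1' hgt
      exact ⟨by simp [hgt, this], by constructor <;> intro <;> linarith⟩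
  have key : ∀ y, κ.φ y ∈ B → y ∈ κ.φ.source → κ'.φ y 2 ≠ 0 → κ.φ y 2 ≠ 0 ∧
      h (κ.φ y) = κ'.φ y 2 := by
    intro y hyB hys hy0
    have e : h (κ.φ y) = κ'.φ y 2 := by simp only [hh]; rw [κ.φ.left_inv hys]
    exact ⟨fun h0 => hy0 (e ▸ (hB _ hyB).2.2.1 h0), e⟩
  -- Points on the positive and on the negative side of `κ'`. They cannot lie in the same half of
  -- the ball, so the half containing `y₁` decides between the two alternatives.
  obtain ⟨y₁, ⟨-, hy₁⟩, hy₁B, hy₁s, -⟩ := ((κ'.frequently_pos hp').and_eventually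
    (hevB.and hev)).exists
  obtain ⟨y₂, ⟨-, hy₂⟩, hy₂B, hy₂s, -⟩ := ((κ'.frequently_neg hp').and_eventually
    (hevB.and hev)).exists
  obtain ⟨n₁, e₁⟩ := key y₁ hy₁B hy₁s hy₁.ne'
  obtain ⟨n₂, e₂⟩ := key y₂ hy₂B hy₂s hy₂.ne
  have cP : ContinuousOn h (B ∩ {x : Space | 0 < x 2}) := hcont.mono inter_subset_left
  have cN : ContinuousOn h (B ∩ {x : Space | x 2 < 0}) := hcont.mono inter_subset_left
  have nP : ∀ x ∈ B ∩ {x : Space | 0 < x 2}, h x ≠ 0 := fun x hx => hne x hx.1 (ne_of_gt hx.2)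
  have nN : ∀ x ∈ B ∩ {x : Space | x 2 < 0}, h x ≠ 0 := fun x hx => hne x hx.1 (ne_of_lt hx.2)
  have cP' := cP.neg
  have cN' := cN.neg
  have nP' : ∀ x ∈ B ∩ {x : Space | 0 < x 2}, (-h) x ≠ 0 := fun x hx => neg_ne_zero.2 (nP x hx)
  have nN' : ∀ x ∈ B ∩ {x : Space | x 2 < 0}, (-h) x ≠ 0 := fun x hx => neg_ne_zero.2 (nN x hx)
  have hp₁ : 0 < h (κ.φ y₁) := e₁ ▸ hy₁
  have hp₂ : 0 < (-h) (κ.φ y₂) := by simpa [e₂] using hy₂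
  rcases n₁.lt_or_gt with l₁ | l₁
  · have hN := sign_const_of_isPreconnected hneg cN nN ⟨hy₁B, l₁⟩ hp₁
    have l₂ : 0 < κ.φ y₂ 2 := by
      refine n₂.lt_or_gt.resolve_left fun l₂ => ?_
      have := hN _ ⟨hy₂B, l₂⟩
      simp at hp₂; linarith
    have hP := sign_const_of_isPreconnected hpos cP' nP' ⟨hy₂B, l₂⟩ hp₂
    refine Or.inr (conclude _ (by simp) ?_ ?_ ?_)
    · intro x hx h0; simpa using hP x ⟨hx, h0⟩
    · intro x hx h0; simpa using hN x ⟨hx, h0⟩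
    · intro x hx h0; simpa using (hB x hx).2.2.1 h0
  · have hP := sign_const_of_isPreconnected hpos cP nP ⟨hy₁B, l₁⟩ hp₁
    have l₂ : κ.φ y₂ 2 < 0 := by
      refine n₂.lt_or_gt.resolve_right fun l₂ => ?_
      have := hP _ ⟨hy₂B, l₂⟩
      simp at hp₂; linarith
    have hN := sign_const_of_isPreconnected hneg cN' nN' ⟨hy₂B, l₂⟩ hp₂
    refine Or.inl (conclude _ rfl ?_ ?_ ?_)
    · intro x hx h0; exact hP x ⟨hx, h0⟩
    · intro x hx h0; simpa using hN x ⟨hx, h0⟩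
    · intro x hx h0; exact (hB x hx).2.2.1 h0

theorem SameSides.posSide_eq {κ κ' : FlatChart L} {p : F} (h : SameSides κ κ' p) :
    κ.posSide p = κ'.posSide p := by
  refine nhdsWithin_eq_iff_eventuallyEq.2 ?_
  filter_upwards [h] with y hy
  exact propext (and_congr (iff_of_true hy.1.1 hy.1.2) hy.2.1)

theorem SameSides.negSide_eq {κ κ' : FlatChart L} {p : F} (h : SameSides κ κ' p) :
    κ.negSide p = κ'.negSide p := by
  refine nhdsWithin_eq_iff_eventuallyEq.2 ?_
  filter_upwards [h] with y hy
  exact propext (and_congr (iff_of_true hy.1.1 hy.1.2) hy.2.2)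

theorem SameSides.eventually {κ κ' : FlatChart L} {p : F} (h : SameSides κ κ' p) :
    ∀ᶠ p' in 𝓝 p, SameSides κ κ' p' :=
  (L.continuous_proj.tendsto p).eventually (eventually_eventually_nhds.2 h)

/-- Points with `z > 0` accumulate at `p`; if the filters were equal, those close to `p` would also
have `z < 0`. -/
theorem posSide_ne_negSide (κ : FlatChart L) {p : F} (hp : p ∈ range κ.ψ) :
    κ.posSide p ≠ κ.negSide p := by
  intro h
  have h1 : {y | y ∈ κ.φ.source ∧ κ.φ y 2 < 0} ∈ κ.posSide p := h ▸ self_mem_nhdsWithin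
  have h2 := eventually_nhdsWithin_iff.1 h1
  obtain ⟨y, hy, hy'⟩ := ((κ.frequently_pos hp).and_eventually h2).exists
  exact lt_asymm hy.2 (hy' hy).2

theorem negSide_eq_of_posSide_eq {κ κ' : FlatChart L} {p : F} (hp : p ∈ range κ.ψ)
    (hp' : p ∈ range κ'.ψ) (h : κ.posSide p = κ'.posSide p) : κ.negSide p = κ'.negSide p := by
  rcases sameSides_or_flip κ κ' hp hp' with hs | hs
  · exact hs.negSide_eq
  · have := hs.posSide_eq
    rw [flip_posSide, h] at this
    exact absurd this (κ'.posSide_ne_negSide hp')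

end FlatChart

/-! ### Normal orientations on discs and opposite orientations -/

namespace NormalOrientation

variable {S : Set F}

theorem ext_side {n n' : NormalOrientation L S} (h : ∀ p, n.side p = n'.side p) : n = n' := by
  cases n; cases n'
  congr
  exact funext h

theorem exists_chart (n : NormalOrientation L S) (p : S) :
    ∃ κ : FlatChart L, p.1 ∈ range κ.ψ ∧ n.side p = κ.posSide p.1 := by
  obtain ⟨κ, hκ⟩ := n.locally_const p
  exact ⟨κ, hκ.self_of_nhds⟩

theorem subset_immersedSet (n : NormalOrientation L S) : S ⊆ L.immersedSet := fun p hp =>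
  let ⟨κ, hκ, _⟩ := n.exists_chart ⟨p, hp⟩
  ⟨κ, hκ⟩

/-- Local constancy, known in some chart at `p`, passes to any chart at `p` because the two charts
have the same sides up to a flip. -/
theorem eventually_eq_posSide_or (n : NormalOrientation L S) (κ : FlatChart L) (p : S)
    (hp : p.1 ∈ range κ.ψ) :
    (∀ᶠ q : S in 𝓝 p, n.side q = κ.posSide q.1) ∨ ∀ᶠ q : S in 𝓝 p, n.side q = κ.negSide q.1 := by
  obtain ⟨κ', hκ'⟩ := n.locally_const p
  have hc : Tendsto (Subtype.val : S → F) (𝓝 p) (𝓝 p.1) := continuous_subtype_val.tendsto p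
  rcases FlatChart.sameSides_or_flip κ' κ hκ'.self_of_nhds.1 hp with h | h
  · left
    filter_upwards [hκ', hc.eventually h.eventually] with q hq hs
    rw [hq.2, hs.posSide_eq]
  · right
    filter_upwards [hκ', hc.eventually h.eventually] with q hq hs
    rw [hq.2, hs.posSide_eq, FlatChart.flip_posSide]

/-- A normal orientation points to one side of a disc. -/
theorem forall_eq_posSide_or (n : NormalOrientation L S) (κ : FlatChart L)
    (hS : range κ.ψ ⊆ S) :
    (∀ a, n.side ⟨κ.ψ a, hS (mem_range_self a)⟩ = κ.posSide (κ.ψ a)) ∨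
      ∀ a, n.side ⟨κ.ψ a, hS (mem_range_self a)⟩ = κ.negSide (κ.ψ a) := by
  have hc : Continuous (fun a => (⟨κ.ψ a, hS (mem_range_self a)⟩ : S)) :=
    κ.isOpenEmbedding.continuous.subtype_mk _
  have hloc : ∀ a, (∀ᶠ b in 𝓝 a, n.side ⟨κ.ψ b, hS (mem_range_self b)⟩ = κ.posSide (κ.ψ b)) ∨
      ∀ᶠ b in 𝓝 a, n.side ⟨κ.ψ b, hS (mem_range_self b)⟩ = κ.negSide (κ.ψ b) := fun a =>
    (n.eventually_eq_posSide_or κ ⟨κ.ψ a, hS (mem_range_self a)⟩ (mem_range_self a)).imp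
      (fun h => (hc.tendsto a).eventually h) (fun h => (hc.tendsto a).eventually h)
  have hne : ∀ a, κ.posSide (κ.ψ a) ≠ κ.negSide (κ.ψ a) := fun a =>
    κ.posSide_ne_negSide (mem_range_self a)
  -- The two alternatives are locally constant and exclude each other, so connectedness of the plane
  -- leaves only one.
  have hcl : IsClopen {a | n.side ⟨κ.ψ a, hS (mem_range_self a)⟩ = κ.posSide (κ.ψ a)} := by
    refine ⟨⟨isOpen_iff_mem_nhds.2 fun a ha => ?_⟩, isOpen_iff_mem_nhds.2 fun a ha => ?_⟩
    · refine ((hloc a).resolve_left fun h => ha h.self_of_nhds).mono fun b hb hb' => ?_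
      exact hne b (hb'.symm.trans hb)
    · refine (hloc a).resolve_right fun h => ?_
      exact hne a (ha.symm.trans h.self_of_nhds)
  rcases isClopen_iff.1 hcl with h | h
  · right
    intro a
    exact ((hloc a).resolve_left fun h' =>
      (h ▸ (show a ∈ {a | _} from h'.self_of_nhds) : a ∈ (∅ : Set Plane))).self_of_nhds
  · left
    intro a
    exact (h ▸ mem_univ a : a ∈ {a | _})

theorem IsOpposite.symm {n n' : NormalOrientation L S} (h : n.IsOpposite n') :
    n'.IsOpposite n := fun p =>
  let ⟨κ, hp, h1, h2⟩ := h p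
  ⟨κ.flip, hp, by simpa using h2, by simpa using h1⟩

theorem IsOpposite.eq_of_isOpposite {n n' n'' : NormalOrientation L S} (h : n.IsOpposite n')
    (h' : n'.IsOpposite n'') : n = n'' := by
  refine ext_side fun p => ?_
  obtain ⟨κ, hp, h1, h2⟩ := h p
  obtain ⟨κ', hp', h1', h2'⟩ := h' p
  rw [h1, h2']
  have := FlatChart.negSide_eq_of_posSide_eq (κ := κ.flip) hp hp'
    (by rw [FlatChart.flip_posSide, ← h2, h1'])
  simpa using this

end NormalOrientation

theorem PointsFrom.swap {S : Set F} {n n' : NormalOrientation L S} (h : n.IsOpposite n') (p : S)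
    {γ₁ γ₂ : L.Region} (hp : L.PointsFrom p.1 (n.side p) γ₁ γ₂) :
    L.PointsFrom p.1 (n'.side p) γ₂ γ₁ := by
  obtain ⟨κ, hκ, h1, h2⟩ := h p
  obtain ⟨κ', hκ', h1', hneg, hpos⟩ := hp
  have hneg' := FlatChart.negSide_eq_of_posSide_eq hκ hκ' (h1.symm.trans h1')
  refine ⟨κ'.flip, hκ', ?_, ?_, ?_⟩ <;> simp_all

/-! ### Normal orientations around a double point curve -/

namespace DoubleChart

/-- The coordinate change that moves the `i`-th coordinate (`i = 0, 1`) to the last place. -/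
def coordChange : Fin 2 → Space ≃ₜ Space
  | 0 =>
    { toFun := fun y => ![y 1, y 2, y 0]
      invFun := fun y => ![y 2, y 0, y 1]
      left_inv := fun y => by funext k; fin_cases k <;> simp
      right_inv := fun y => by funext k; fin_cases k <;> simp
      continuous_toFun := by fun_prop
      continuous_invFun := by fun_prop }
  | 1 =>
    { toFun := fun y => ![y 0, y 2, y 1]
      invFun := fun y => ![y 0, y 2, y 1]
      left_inv := fun y => by funext k; fin_cases k <;> simp
      right_inv := fun y => by funext k; fin_cases k <;> simp
      continuous_toFun := by fun_prop
      continuous_invFun := by fun_prop }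

theorem coordChange_model (i : Fin 2) (a : Plane) :
    coordChange i (doubleModel i a) = ![a 0, a 1, 0] := by
  fin_cases i <;> funext k <;> fin_cases k <;> simp [coordChange, doubleModel]

theorem coordChange_two (i : Fin 2) (y : Space) : coordChange i y 2 = y i.castSucc := by
  fin_cases i <;> simp [coordChange]

theorem proj_mem_source (χ : DoubleChart L) (i : Fin 2) (a : Plane) :
    L.proj (χ.ψ i a) ∈ χ.φ.source := by
  rw [← mem_preimage, χ.preimage_eq]
  exact mem_iUnion.2 ⟨i, a, rfl⟩

/-- The sheet `i` of a double point chart, as a flat disc. -/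
def flat (χ : DoubleChart L) (i : Fin 2) : FlatChart L where
  φ := χ.φ.trans (coordChange i).toOpenPartialHomeomorph
  ψ := χ.ψ i
  isOpenEmbedding := χ.isOpenEmbedding i
  mem_source a := by simpa using χ.proj_mem_source i a
  map_eq a := by simp [χ.map_eq, coordChange_model]

theorem side_one (χ : DoubleChart L) (i : Fin 2) (a : Plane) :
    χ.side i a 1 = (χ.flat i).posSide (χ.ψ i a) := by
  simp [side, FlatChart.posSide, flat, coordChange_two]

theorem side_neg_one (χ : DoubleChart L) (i : Fin 2) (a : Plane) :
    χ.side i a (-1) = (χ.flat i).negSide (χ.ψ i a) := by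
  simp [side, FlatChart.negSide, flat, coordChange_two]

theorem mem_immersedSet (χ : DoubleChart L) (i : Fin 2) (a : Plane) :
    χ.ψ i a ∈ L.immersedSet := ⟨χ.flat i, mem_range_self a⟩

theorem side_injective (χ : DoubleChart L) (i : Fin 2) (a : Plane) {ε ε' : ℤˣ}
    (h : χ.side i a ε = χ.side i a ε') : ε = ε' := by
  have : (χ.flat i).posSide (χ.ψ i a) ≠ (χ.flat i).negSide (χ.ψ i a) :=
    (χ.flat i).posSide_ne_negSide (mem_range_self a)
  rw [← side_one, ← side_neg_one] at this
  rcases Int.units_eq_one_or ε with rfl | rfl <;> rcases Int.units_eq_one_or ε' with rfl | rfl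
  · rfl
  · exact absurd h this
  · exact absurd h.symm this
  · rfl

/-- An orientation of the diagram points to one side of each of the two sheets that meet at a
double point curve. -/
theorem exists_forall_side_eq (χ : DoubleChart L) (o : L.Orientation) (i : Fin 2) :
    ∃ ε : ℤˣ, ∀ a, o.side ⟨χ.ψ i a, χ.mem_immersedSet i a⟩ = χ.side i a ε := by
  have hS : range (χ.flat i).ψ ⊆ L.immersedSet := by
    rintro _ ⟨a, rfl⟩
    exact χ.mem_immersedSet i a
  rcases o.forall_eq_posSide_or (χ.flat i) hS with h | h
  · exact ⟨1, fun a => (h a).trans (χ.side_one i a).symm⟩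
  · exact ⟨-1, fun a => (h a).trans (χ.side_neg_one i a).symm⟩

end DoubleChart

/-! ### Assignments whose normal orientations come from an orientation of the diagram -/

section Assignment

variable {X : Type v}

/-- The normal orientations of `A` are those of the orientation `o`. -/
def Assignment.Follows (A : Assignment L X) (o : L.Orientation) : Prop :=
  ∀ (s : L.SemiSheet) (p : F) (hs : p ∈ s.carrier) (hi : p ∈ L.immersedSet),
    o.side ⟨p, hi⟩ = (A.normal s).side ⟨p, hs⟩

namespace Assignment.Follows

variable {A B : Assignment L X} {o : L.Orientation}

/-- Carrying a normal orientation forces a semi-sheet to avoid the points without flat charts, so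
`o` prescribes a side at each of its points. -/
theorem normal_eq (hA : A.Follows o) (hB : B.Follows o) : A.normal = B.normal := by
  funext s
  refine NormalOrientation.ext_side fun p => ?_
  have hi := (A.normal s).subset_immersedSet p.2
  exact (hA s p.1 p.2 hi).symm.trans (hB s p.1 p.2 hi)

/-- `Directed` is tested at a base point off the curve, `IsColoring` at the centre of the chart. As
`o` points to one side of the whole disc, the point of evaluation does not matter. -/
theorem directed_iff (hA : A.Follows o) (χ : DoubleChart L) (i : Fin 2) (δ ε : ℤˣ) (a : Plane) :
    A.Directed χ i δ ε ↔ o.side ⟨χ.ψ i a, χ.mem_immersedSet i a⟩ = χ.side i a ε := by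
  obtain ⟨ε', h⟩ := χ.exists_forall_side_eq o i
  rw [Assignment.Directed, ← hA _ _ _ (χ.mem_immersedSet i _), h, h]
  constructor
  · intro h'
    rw [χ.side_injective i _ h']
  · intro h'
    rw [χ.side_injective i _ h']

theorem coherent (hA : A.Follows o) (χ : DoubleChart L) (i : Fin 2) : A.Coherent χ i := by
  obtain ⟨ε, h⟩ := χ.exists_forall_side_eq o i
  exact ⟨ε, (hA.directed_iff χ i 1 ε 0).2 (h 0), (hA.directed_iff χ i (-1) ε 0).2 (h 0)⟩

end Assignment.Follows

/-! ### Inversion classes and the uniqueness of canonical forms -/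

variable [SymmetricQuandle X]

/-- Two assignments agree up to the inversions of some semi-sheets. -/
def Assignment.InversionEquiv (A B : Assignment L X) : Prop :=
  ∀ s, (A.normal s = B.normal s ∧ A.label s = B.label s) ∨
    ((A.normal s).IsOpposite (B.normal s) ∧ B.label s = SymmetricQuandle.rho (A.label s))

/-- Inversions at different semi-sheets do not interact, and two at the same one cancel, since `ρ`
and the passage to the opposite normal orientation are involutive. Hence a chain of basic inversions
is recorded by one bit per semi-sheet. -/
theorem Assignment.inversionEquiv_of_eq {A B : {A : Assignment L X // A.IsValid}}
    (h : (Quot.mk _ A : L.SymColoring X) = Quot.mk _ B) : A.1.InversionEquiv B.1 := by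
  have h' : Relation.EqvGen BasicInversion A B := Quot.eqvGen_exact h
  clear h
  induction h' with
  | rel A B h =>
    obtain ⟨s, h1, h2, h3⟩ := h
    intro t
    by_cases ht : t = s
    · subst ht
      exact Or.inr ⟨h1, h2⟩
    · exact Or.inl ⟨(h3 t ht).1.symm, (h3 t ht).2.symm⟩
  | refl A => exact fun s => Or.inl ⟨rfl, rfl⟩
  | symm A B hAB ih =>
    intro s
    rcases ih s with ⟨h1, h2⟩ | ⟨h1, h2⟩
    · exact Or.inl ⟨h1.symm, h2.symm⟩
    · exact Or.inr ⟨h1.symm, by rw [h2, SymmetricQuandle.rho_rho]⟩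
  | trans A B C hAB hBC ih ih' =>
    intro s
    rcases ih s with ⟨h1, h2⟩ | ⟨h1, h2⟩ <;>
      rcases ih' s with ⟨h1', h2'⟩ | ⟨h1', h2'⟩
    · exact Or.inl ⟨h1.trans h1', h2.trans h2'⟩
    · exact Or.inr ⟨h1 ▸ h1', h2 ▸ h2'⟩
    · exact Or.inr ⟨h1' ▸ h1, h2' ▸ h2⟩
    · exact Or.inl ⟨h1.eq_of_isOpposite h1', by rw [h2', h2, SymmetricQuandle.rho_rho]⟩

end Assignment

/-- The canonical form of a coloring by the symmetric double is unique. -/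
theorem IsCanonicalForm.unique {X : Type v} [Quandle X] {c : L.SymColoring (QuandleDouble X)}
    {A B : {A : Assignment L (QuandleDouble X) // A.IsValid}} (hA : IsCanonicalForm c A)
    (hB : IsCanonicalForm c B) : A = B := by
  have h := Assignment.inversionEquiv_of_eq (hA.1.trans hB.1.symm)
  have h' : ∀ s, A.1.normal s = B.1.normal s ∧ A.1.label s = B.1.label s := by
    intro s
    refine (h s).resolve_right ?_
    rintro ⟨-, h2⟩
    have h3 := congrArg QuandleDouble.sign h2
    have h4 : (SymmetricQuandle.rho (A.1.label s)).sign = -(A.1.label s).sign := rfl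
    rw [h4, hA.2, hB.2] at h3
    exact absurd h3 (by decide)
  exact Subtype.ext (Assignment.ext (funext fun s => (h' s).1) (funext fun s => (h' s).2))

theorem SymShadowColoring.induces_iff {X : Type v} [Quandle X] {Y : Type w}
    [MulAction (AssocGroup X)ᵐᵒᵖ Y] {C : L.SymShadowColoring (QuandleDouble X) Y}
    {A : {A : Assignment L (QuandleDouble X) // A.IsValid}} (hA : IsCanonicalForm C.color A)
    (o : L.Orientation) : C.Induces o ↔ A.1.Follows o := by
  constructor
  · rintro ⟨B, hB, h⟩
    rwa [hA.unique hB]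
  · exact fun h => ⟨A, hA, h⟩

/-! ### Sheets as unions of semi-sheets -/

theorem _root_.ConnectedComponents.mk_eq_mk_of_isPreconnected {α : Type*} [TopologicalSpace α]
    {P : α → Prop} {S : Set α} (hS : IsPreconnected S) (hSP : ∀ p ∈ S, P p) {p q : α}
    (hp : p ∈ S) (hq : q ∈ S) :
    ConnectedComponents.mk (⟨p, hSP p hp⟩ : {p // P p}) = ConnectedComponents.mk ⟨q, hSP q hq⟩ := by
  have hT : IsPreconnected (Subtype.val ⁻¹' S : Set {p // P p}) := by
    have hval : IsInducing (Subtype.val : {p // P p} → α) := ⟨rfl⟩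
    refine hval.isPreconnected_image.1 ?_
    rwa [image_preimage_eq_of_subset fun p hp => mem_range.2 ⟨⟨p, hSP p hp⟩, rfl⟩]
  exact ConnectedComponents.coe_eq_coe'.2
    (hT.subset_connectedComponent (show _ ∈ Subtype.val ⁻¹' S from hq) hp)

theorem semiSheetAt_eq {S : Set F} (hS : IsPreconnected S) (hSW : ∀ p ∈ S, p ∉ closure L.doubleSet)
    {p q : F} (hp : p ∈ S) (hq : q ∈ S) (hp' : p ∉ closure L.doubleSet)
    (hq' : q ∉ closure L.doubleSet) : L.semiSheetAt p hp' = L.semiSheetAt q hq' :=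
  ConnectedComponents.mk_eq_mk_of_isPreconnected hS hSW hp hq

theorem sheetAt_eq {S : Set F} (hS : IsPreconnected S) (hSW : ∀ p ∈ S, p ∉ closure L.lowerSet)
    {p q : F} (hp : p ∈ S) (hq : q ∈ S) (hp' : p ∉ closure L.lowerSet)
    (hq' : q ∉ closure L.lowerSet) : L.sheetAt p hp' = L.sheetAt q hq' :=
  ConnectedComponents.mk_eq_mk_of_isPreconnected hS hSW hp hq

theorem DoubleChart.sheet_semiSheet (χ : DoubleChart L) (ε : ℤˣ) :
    (χ.semiSheet 0 ε).sheet = χ.overSheet := by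
  refine sheetAt_eq (isPreconnected_range (χ.isOpenEmbedding 0).continuous) ?_
    (mem_range_self (base ε)) (mem_range_self 0) _ _
  rintro _ ⟨a, rfl⟩
  exact χ.notMem_closure_lowerSet a

theorem DoubleChart.semiSheetAt_eq (χ : DoubleChart L) (i : Fin 2) {a b : Plane}
    (h : 0 < a 0 * b 0) (ha : χ.ψ i a ∉ closure L.doubleSet)
    (hb : χ.ψ i b ∉ closure L.doubleSet) :
    L.semiSheetAt (χ.ψ i a) ha = L.semiSheetAt (χ.ψ i b) hb := by
  have hlin : IsLinearMap ℝ (fun x : Plane => x 0 * b 0) :=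
    ⟨fun _ _ => add_mul _ _ _, fun _ _ => mul_assoc _ _ _⟩
  have hb0 : b 0 ≠ 0 := right_ne_zero_of_mul h.ne'
  refine SurfaceLink.semiSheetAt_eq (S := χ.ψ i '' {x | 0 < x 0 * b 0})
    ((convex_halfSpace_gt hlin 0).isPreconnected.image _ (χ.isOpenEmbedding i).continuous.continuousOn)
    ?_ (mem_image_of_mem _ h) (mem_image_of_mem _ (mul_self_pos.2 hb0)) _ _
  rintro _ ⟨x, hx, rfl⟩
  exact χ.notMem_closure_doubleSet i (left_ne_zero_of_mul (ne_of_gt hx))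

/-! ### Regular points and branch points -/

namespace LocalChart

variable {k : ℕ} {m : Fin k → Plane → Space}

theorem ψ_mem_source (c : LocalChart L m) (i : Fin k) (a : Plane) :
    L.proj (c.ψ i a) ∈ c.φ.source := by
  rw [← mem_preimage, c.preimage_eq]
  exact mem_iUnion.2 ⟨i, a, rfl⟩

theorem proj_eq_iff (c : LocalChart L m) {i j : Fin k} {a b : Plane} :
    L.proj (c.ψ i a) = L.proj (c.ψ j b) ↔ m i a = m j b := by
  rw [← c.map_eq, ← c.map_eq]
  exact (c.φ.injOn.eq_iff (c.ψ_mem_source i a) (c.ψ_mem_source j b)).symm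

theorem exists_of_proj_eq (c : LocalChart L m) {i : Fin k} {a : Plane} {p : F}
    (h : L.proj p = L.proj (c.ψ i a)) : ∃ j b, p = c.ψ j b ∧ m j b = m i a := by
  have hp : p ∈ L.proj ⁻¹' c.φ.source := by
    rw [mem_preimage, h]
    exact c.ψ_mem_source i a
  rw [c.preimage_eq] at hp
  obtain ⟨j, b, rfl⟩ := mem_iUnion.1 hp
  exact ⟨j, b, rfl, c.proj_eq_iff.1 h⟩

theorem CentredAt.exists_eq {c : LocalChart L m} {p : F} (h : c.CentredAt (L.proj p)) :
    ∃ i a, p = c.ψ i a ∧ m i a = 0 := by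
  have hp : p ∈ L.proj ⁻¹' c.φ.source := h.1
  rw [c.preimage_eq] at hp
  obtain ⟨j, b, rfl⟩ := mem_iUnion.1 hp
  exact ⟨j, b, rfl, (c.map_eq j b).symm.trans h.2⟩

theorem ψ_ne (c : LocalChart L m) {i j : Fin k} (h : i ≠ j) (a b : Plane) :
    c.ψ i a ≠ c.ψ j b := fun e =>
  Set.disjoint_left.1 (c.disjoint i j h) (mem_range_self a) (e ▸ mem_range_self b)

theorem regular_notMem_doubleSet (c : LocalChart L regularModel) (i : Fin 1) (a : Plane) :
    c.ψ i a ∉ L.doubleSet := by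
  rintro ⟨p', hne, h⟩
  obtain ⟨j, b, rfl, hm⟩ := c.exists_of_proj_eq h
  obtain rfl : j = i := Subsingleton.elim _ _
  have h0 := congrFun hm 0
  have h1 := congrFun hm 1
  simp only [regularModel, Matrix.cons_val_zero, Matrix.cons_val_one] at h0 h1
  refine hne (congrArg _ ?_)
  funext k; fin_cases k
  · exact h0
  · exact h1

theorem regular_notMem_closure_doubleSet (c : LocalChart L regularModel) (i : Fin 1) (a : Plane) :
    c.ψ i a ∉ closure L.doubleSet := by
  intro hcl
  obtain ⟨_, ⟨b, rfl⟩, hb⟩ :=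
    mem_closure_iff.1 hcl _ (c.isOpenEmbedding i).isOpen_range (mem_range_self a)
  exact c.regular_notMem_doubleSet i b hb

theorem eq_zero_of_branchModel_eq_zero {i : Fin 1} {a : Plane} (h : branchModel i a = 0) :
    a = 0 := by
  have h1 := congrFun h 1
  have h2 := congrFun h 2
  simp [branchModel] at h1 h2
  funext k; fin_cases k
  · exact h1
  · exact h2

theorem height_ne {p q : F} (hne : p ≠ q) (h : L.proj p = L.proj q) : L.height p ≠ L.height q :=
  fun h' => hne (L.isEmbedding.injective (Prod.ext h h'))

/-- The Whitney umbrella identifies `(0, t)` with `(0, -t)`. Their heights differ because the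
surface is embedded, so one of the two is a lower point, and both tend to the branch point. -/
theorem branch_mem_closure_lowerSet (c : LocalChart L branchModel) (i : Fin 1) :
    c.ψ i 0 ∈ closure L.lowerSet := by
  refine mem_closure_iff_nhds.2 fun U hU => ?_
  have hc1 : Continuous (fun t : ℝ => c.ψ i ![0, t]) :=
    (c.isOpenEmbedding i).continuous.comp (by fun_prop)
  have hc2 : Continuous (fun t : ℝ => c.ψ i ![0, -t]) :=
    (c.isOpenEmbedding i).continuous.comp (by fun_prop)
  have e1 : c.ψ i ![0, (0 : ℝ)] = c.ψ i 0 := by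
    congr 1; funext k; fin_cases k <;> rfl
  have e2 : c.ψ i ![0, -(0 : ℝ)] = c.ψ i 0 := by rw [neg_zero, e1]
  have h1 : ∀ᶠ t in 𝓝[≠] (0 : ℝ), c.ψ i ![0, t] ∈ U :=
    nhdsWithin_le_nhds (hc1.tendsto 0 (by rwa [e1]))
  have h2 : ∀ᶠ t in 𝓝[≠] (0 : ℝ), c.ψ i ![0, -t] ∈ U :=
    nhdsWithin_le_nhds (hc2.tendsto 0 (by rwa [e2]))
  obtain ⟨t, ht1, ht2, ht⟩ := (h1.and (h2.and self_mem_nhdsWithin)).exists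
  have hproj : L.proj (c.ψ i ![0, t]) = L.proj (c.ψ i ![0, -t]) := by
    rw [c.proj_eq_iff]
    funext k; fin_cases k <;> simp [branchModel]
  have hne : c.ψ i ![0, t] ≠ c.ψ i ![0, -t] := by
    intro h
    have h' := congrFun ((c.isOpenEmbedding i).injective h) 1
    simp only [Matrix.cons_val_one, Matrix.cons_val_fin_one] at h'
    exact ht (self_eq_neg.1 h')
  rcases (height_ne hne hproj).lt_or_gt with hlt | hlt
  · exact ⟨_, ht1, _, hproj.symm, hlt⟩
  · exact ⟨_, ht2, _, hproj, hlt⟩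

end LocalChart

/-! ### The top sheet at a triple point -/

namespace TripleChart

theorem ψ_zero_notMem_lowerSet (τ : TripleChart L) (a : Plane) : τ.ψ 0 a ∉ L.lowerSet := by
  rintro ⟨p', h, hlt⟩
  obtain ⟨j, b, rfl, hm⟩ := τ.exists_of_proj_eq h
  have h0 := congrFun hm 0
  have h1 := congrFun hm 1
  have h2 := congrFun hm 2
  fin_cases j <;> simp [tripleModel] at h0 h1 h2
  · have : b = a := by funext k; fin_cases k <;> assumption
    subst this
    exact lt_irrefl _ hlt
  · have ea : a = ![0, a 1] := by funext k; fin_cases k <;> simp [← h1]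
    have eb : b = ![0, a 1] := by funext k; fin_cases k <;> simp [h0, h2]
    rw [ea, eb] at hlt
    exact lt_asymm hlt (by simpa using τ.top_middle (a 1))
  · have ea : a = ![a 0, 0] := by funext k; fin_cases k <;> simp [← h2]
    have eb : b = ![0, a 0] := by funext k; fin_cases k <;> simp [h0, h1]
    rw [ea, eb] at hlt
    exact lt_asymm hlt (by simpa using τ.top_bottom (a 0))

theorem notMem_closure_lowerSet (τ : TripleChart L) (a : Plane) :
    τ.ψ 0 a ∉ closure L.lowerSet := by
  intro hcl
  obtain ⟨_, ⟨b, rfl⟩, hb⟩ :=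
    mem_closure_iff.1 hcl _ (τ.isOpenEmbedding 0).isOpen_range (mem_range_self a)
  exact τ.ψ_zero_notMem_lowerSet b hb

theorem notMem_closure_doubleSet (τ : TripleChart L) {a : Plane} (h0 : a 0 ≠ 0) (h1 : a 1 ≠ 0) :
    τ.ψ 0 a ∉ closure L.doubleSet := by
  have hopen : IsOpen (τ.ψ 0 '' {a : Plane | a 0 ≠ 0 ∧ a 1 ≠ 0}) :=
    (τ.isOpenEmbedding 0).isOpenMap _ ((isOpen_ne_fun (continuous_apply 0) continuous_const).inter
      (isOpen_ne_fun (continuous_apply 1) continuous_const))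
  intro hcl
  obtain ⟨p, ⟨b, hb, rfl⟩, p', hne, hp'⟩ :=
    mem_closure_iff.1 hcl _ hopen (mem_image_of_mem _ ⟨h0, h1⟩)
  obtain ⟨j, x, rfl, hm⟩ := τ.exists_of_proj_eq hp'
  have m0 := congrFun hm 0
  have m1 := congrFun hm 1
  have m2 := congrFun hm 2
  fin_cases j <;> simp [tripleModel] at m0 m1 m2
  · have : x = b := by funext k; fin_cases k <;> assumption
    exact hne (this ▸ rfl)
  · exact hb.1 m1.symm
  · exact hb.2 m2.symm

theorem proj_edge_zero (τ : TripleChart L) (t : ℝ) :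
    L.proj (τ.ψ 1 ![0, t]) = L.proj (τ.ψ 0 ![0, t]) := by
  rw [τ.proj_eq_iff]; simp [tripleModel]

theorem proj_edge_one (τ : TripleChart L) (t : ℝ) :
    L.proj (τ.ψ 2 ![0, t]) = L.proj (τ.ψ 0 ![t, 0]) := by
  rw [τ.proj_eq_iff]; simp [tripleModel]

/-- Away from the triple point, the axis `a 0 = 0` of the top sheet meets only the middle sheet.
Together with its analogue for the bottom sheet, this makes the half-axes honest double point
curves. -/
theorem eq_of_proj_eq_edge_zero (τ : TripleChart L) {t : ℝ} (ht : t ≠ 0) {p : F}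
    (h : L.proj p = L.proj (τ.ψ 0 ![0, t])) : p = τ.ψ 0 ![0, t] ∨ p = τ.ψ 1 ![0, t] := by
  obtain ⟨j, x, rfl, hm⟩ := τ.exists_of_proj_eq h
  have m0 := congrFun hm 0
  have m1 := congrFun hm 1
  have m2 := congrFun hm 2
  fin_cases j <;> simp [tripleModel] at m0 m1 m2
  · left; congr 1; funext k; fin_cases k <;> simpa
  · right; congr 1; funext k; fin_cases k <;> simpa
  · exact absurd m2.symm ht

theorem eq_of_proj_eq_edge_one (τ : TripleChart L) {t : ℝ} (ht : t ≠ 0) {p : F}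
    (h : L.proj p = L.proj (τ.ψ 0 ![t, 0])) : p = τ.ψ 0 ![t, 0] ∨ p = τ.ψ 2 ![0, t] := by
  obtain ⟨j, x, rfl, hm⟩ := τ.exists_of_proj_eq h
  have m0 := congrFun hm 0
  have m1 := congrFun hm 1
  have m2 := congrFun hm 2
  fin_cases j <;> simp [tripleModel] at m0 m1 m2
  · left; congr 1; funext k; fin_cases k <;> simpa
  · exact absurd m1.symm ht
  · right; congr 1; funext k; fin_cases k <;> simpa

theorem semiSheetAt_eq (τ : TripleChart L) {a b : Plane} (h0 : 0 < a 0 * b 0)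
    (h1 : 0 < a 1 * b 1) (ha : τ.ψ 0 a ∉ closure L.doubleSet)
    (hb : τ.ψ 0 b ∉ closure L.doubleSet) :
    L.semiSheetAt (τ.ψ 0 a) ha = L.semiSheetAt (τ.ψ 0 b) hb := by
  have hlin : ∀ i, IsLinearMap ℝ (fun x : Plane => x i * b i) := fun i =>
    ⟨fun _ _ => add_mul _ _ _, fun _ _ => mul_assoc _ _ _⟩
  refine SurfaceLink.semiSheetAt_eq (S := τ.ψ 0 '' ({x | 0 < x 0 * b 0} ∩ {x | 0 < x 1 * b 1}))
    (((convex_halfSpace_gt (hlin 0) 0).inter (convex_halfSpace_gt (hlin 1) 0)).isPreconnected.image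
      _ (τ.isOpenEmbedding 0).continuous.continuousOn)
    ?_ (mem_image_of_mem _ ⟨h0, h1⟩) (mem_image_of_mem _
      ⟨mul_self_pos.2 (right_ne_zero_of_mul h0.ne'), mul_self_pos.2 (right_ne_zero_of_mul h1.ne')⟩)
    _ _
  rintro _ ⟨x, hx, rfl⟩
  exact τ.notMem_closure_doubleSet (left_ne_zero_of_mul (ne_of_gt hx.1))
    (left_ne_zero_of_mul (ne_of_gt hx.2))

end TripleChart

/-- A point off the lower double points is a simple point, or it is on the upper sheet at a double
point or on the top sheet at a triple point. -/
theorem IsGeneric.cases_of_notMem_lowerSet (hL : L.IsGeneric) {p : F}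
    (hp : p ∉ closure L.lowerSet) :
    p ∉ closure L.doubleSet ∨ (∃ χ : DoubleChart L, p = χ.ψ 0 0) ∨
      ∃ τ : TripleChart L, p = τ.ψ 0 0 := by
  rcases hL p with ⟨c, hc⟩ | ⟨c, hc⟩ | ⟨c, hc⟩ | ⟨c, hc⟩
  · obtain ⟨i, a, rfl, -⟩ := hc.exists_eq
    exact Or.inl (c.regular_notMem_closure_doubleSet i a)
  · obtain ⟨i, a, rfl, hm⟩ := hc.exists_eq
    have h0 := congrFun hm 0
    have h1 := congrFun hm 1
    have h2 := congrFun hm 2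
    have ha : a = 0 := by
      fin_cases i <;> simp [doubleModel] at h0 h1 h2 <;> funext k <;> fin_cases k <;> assumption
    subst ha
    right; left
    refine ⟨c, ?_⟩
    fin_cases i
    · rfl
    · refine absurd (subset_closure (s := L.lowerSet) ⟨c.ψ 0 0, ?_, ?_⟩) hp
      · exact c.proj_eq_iff.2 (by simp [doubleModel])
      · have e : (0 : Plane) = ![0, 0] := by funext k; fin_cases k <;> rfl
        simpa [e] using c.height_lt 0
  · obtain ⟨i, a, rfl, hm⟩ := hc.exists_eq
    have h0 := congrFun hm 0
    have h1 := congrFun hm 1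
    have h2 := congrFun hm 2
    have ha : a = 0 := by
      fin_cases i <;> simp [tripleModel] at h0 h1 h2 <;> funext k <;> fin_cases k <;> assumption
    subst ha
    right; right
    refine ⟨c, ?_⟩
    have e : (0 : Plane) = ![0, 0] := by funext k; fin_cases k <;> rfl
    fin_cases i
    · rfl
    · refine absurd (subset_closure (s := L.lowerSet) ⟨c.ψ 0 0, ?_, ?_⟩) hp
      · exact c.proj_eq_iff.2 (by simp [tripleModel])
      · simpa [e] using c.top_middle 0
    · refine absurd (subset_closure (s := L.lowerSet) ⟨c.ψ 0 0, ?_, ?_⟩) hp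
      · exact c.proj_eq_iff.2 (by simp [tripleModel])
      · simpa [e] using c.top_bottom 0
  · obtain ⟨i, a, rfl, hm⟩ := hc.exists_eq
    obtain rfl := LocalChart.eq_zero_of_branchModel_eq_zero hm
    exact absurd (c.branch_mem_closure_lowerSet i) hp

/-- If a point off the lower double points has the same projection as exactly one other point,
then it is on the upper sheet at a double point. -/
theorem IsGeneric.exists_doubleChart (hL : L.IsGeneric) {p q : F} (hp : p ∉ closure L.lowerSet)
    (hne : q ≠ p) (hq : L.proj q = L.proj p) (huniq : ∀ p', L.proj p' = L.proj p → p' = p ∨ p' = q) :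
    ∃ χ : DoubleChart L, p = χ.ψ 0 0 := by
  rcases hL.cases_of_notMem_lowerSet hp with h | h | ⟨τ, rfl⟩
  · exact absurd (subset_closure (s := L.doubleSet) ⟨q, hne, hq⟩) h
  · exact h
  -- At a triple point the middle and bottom sheets give two further preimages, which would both
  -- have to be `q`.
  · have h1 := (huniq (τ.ψ 1 0) (τ.proj_eq_iff.2 (by simp [tripleModel]))).resolve_left
      (τ.ψ_ne (by decide) _ _)
    have h2 := (huniq (τ.ψ 2 0) (τ.proj_eq_iff.2 (by simp [tripleModel]))).resolve_left
      (τ.ψ_ne (by decide) _ _)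
    exact absurd (h1.trans h2.symm) (τ.ψ_ne (by decide) _ _)

/-! ### Descent of functions from semi-sheets to sheets -/

section Extension

variable {Z : Type*} (f : L.SemiSheet → Z)

/-- The function `f` on the semi-sheets has the constant value `z` near `p`. -/
def ConstNear (p : F) (z : Z) : Prop :=
  ∀ᶠ q in 𝓝 p, ∀ hq : q ∉ closure L.doubleSet, f (L.semiSheetAt q hq) = z

variable {f}

theorem constNear_of_notMem_doubleSet {p : F} (hp : p ∉ closure L.doubleSet) :
    ConstNear f p (f (L.semiSheetAt p hp)) := by
  have : LocallyConnectedSpace F :=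
    ChartedSpace.locallyConnectedSpace (EuclideanSpace ℝ (Fin 2)) F
  have hopen : IsOpen (closure L.doubleSet)ᶜ := isClosed_closure.isOpen_compl
  have hmem : p ∈ connectedComponentIn (closure L.doubleSet)ᶜ p := mem_connectedComponentIn hp
  filter_upwards [hopen.connectedComponentIn.mem_nhds hmem] with q hq hq'
  exact congrArg f (semiSheetAt_eq isPreconnected_connectedComponentIn
    (fun x hx => connectedComponentIn_subset _ _ hx) hq hmem _ _)

theorem constNear_double (hf : ∀ χ : DoubleChart L, f (χ.semiSheet 0 1) = f (χ.semiSheet 0 (-1)))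
    (χ : DoubleChart L) : ConstNear f (χ.ψ 0 0) (f (χ.semiSheet 0 1)) := by
  filter_upwards [(χ.isOpenEmbedding 0).isOpen_range.mem_nhds (mem_range_self 0)] with q hq hq'
  obtain ⟨a, rfl⟩ := hq
  have ha : a 0 ≠ 0 := by
    intro h0
    refine hq' (subset_closure ⟨χ.ψ 1 a, χ.ψ_ne (by decide) _ _, χ.proj_eq_iff.2 ?_⟩)
    simp [doubleModel, h0]
  rcases ha.lt_or_gt with h | h
  · rw [hf]
    exact congrArg f (χ.semiSheetAt_eq 0 (by simpa [DoubleChart.base] using h) _ _)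
  · exact congrArg f (χ.semiSheetAt_eq 0 (by simpa [DoubleChart.base] using h) _ _)

/-- Along the path `q`, a parameter `x` is shrunk towards `0` by a positive factor. It keeps its
sign, hence its quadrant in the application, and reaches the region where `f` is known. -/
theorem exists_scale {q : ℝ → F} (hq : Continuous q) {z : Z} (h : ConstNear f (q 0) z) (x : ℝ) :
    ∃ s : ℝ, 0 < s ∧ ∀ hs : q (s * x) ∉ closure L.doubleSet, f (L.semiSheetAt _ hs) = z := by
  have hc : Continuous (fun s : ℝ => q (s * x)) := hq.comp (by fun_prop)
  have h' : ∀ᶠ s in 𝓝[>] (0 : ℝ), ∀ hs : q (s * x) ∉ closure L.doubleSet,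
      f (L.semiSheetAt _ hs) = z :=
    (((hc.tendsto' 0 (q 0) (by simp)).mono_left nhdsWithin_le_nhds).eventually h)
  obtain ⟨s, hs, hs0⟩ := (h'.and self_mem_nhdsWithin).exists
  exact ⟨s, hs0, hs⟩

/-- The two axes cut the top disc into four quadrants. Each point of a half-axis is a double point
with its own double chart, so `f` agrees on the adjacent quadrants, and crossing half-axes links all
four. -/
theorem constNear_triple (hL : L.IsGeneric)
    (hf : ∀ χ : DoubleChart L, f (χ.semiSheet 0 1) = f (χ.semiSheet 0 (-1)))
    (τ : TripleChart L) : ∃ z, ConstNear f (τ.ψ 0 0) z := by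
  have hψ := (τ.isOpenEmbedding 0).continuous
  have edge0 : ∀ t : ℝ, t ≠ 0 → ∃ z, ∀ x : ℝ, x ≠ 0 →
      ∀ h : τ.ψ 0 ![x, t] ∉ closure L.doubleSet, f (L.semiSheetAt _ h) = z := by
    intro t ht
    obtain ⟨χ, hχ⟩ := hL.exists_doubleChart (τ.notMem_closure_lowerSet ![0, t])
      (τ.ψ_ne (by decide) _ _) (τ.proj_edge_zero t) fun p hp => τ.eq_of_proj_eq_edge_zero ht hp
    have hcn := constNear_double hf χ
    rw [← hχ] at hcn
    refine ⟨f (χ.semiSheet 0 1), fun x hx h => ?_⟩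
    obtain ⟨s, hs, hs'⟩ := exists_scale (q := fun r => τ.ψ 0 ![r, t])
      (hψ.comp (by fun_prop)) hcn x
    rw [← hs' (τ.notMem_closure_doubleSet (by simp [hs.ne', hx]) (by simpa using ht))]
    refine congrArg f (τ.semiSheetAt_eq ?_ ?_ _ _)
    · have : x * (s * x) = s * (x * x) := by ring
      simpa [this] using mul_pos hs (mul_self_pos.2 hx)
    · simpa using ht
  have edge1 : ∀ t : ℝ, t ≠ 0 → ∃ z, ∀ x : ℝ, x ≠ 0 →
      ∀ h : τ.ψ 0 ![t, x] ∉ closure L.doubleSet, f (L.semiSheetAt _ h) = z := by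
    intro t ht
    obtain ⟨χ, hχ⟩ := hL.exists_doubleChart (τ.notMem_closure_lowerSet ![t, 0])
      (τ.ψ_ne (by decide) _ _) (τ.proj_edge_one t) fun p hp => τ.eq_of_proj_eq_edge_one ht hp
    have hcn := constNear_double hf χ
    rw [← hχ] at hcn
    refine ⟨f (χ.semiSheet 0 1), fun x hx h => ?_⟩
    obtain ⟨s, hs, hs'⟩ := exists_scale (q := fun r => τ.ψ 0 ![t, r])
      (hψ.comp (by fun_prop)) hcn x
    rw [← hs' (τ.notMem_closure_doubleSet (by simpa using ht) (by simp [hs.ne', hx]))]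
    refine congrArg f (τ.semiSheetAt_eq ?_ ?_ _ _)
    · simpa using ht
    · have : x * (s * x) = s * (x * x) := by ring
      simpa [this] using mul_pos hs (mul_self_pos.2 hx)
  -- `z` is the common value on the two quadrants with `a 0 > 0`. A general point `(a 0, a 1)` is
  -- compared below with `(1, a 1)`, crossing the axis `a 0 = 0` if necessary.
  obtain ⟨z, hz⟩ := edge1 1 one_ne_zero
  refine ⟨z, ?_⟩
  filter_upwards [(τ.isOpenEmbedding 0).isOpen_range.mem_nhds (mem_range_self 0)] with q hq hq'
  obtain ⟨a, rfl⟩ := hq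
  have ea : a = ![a 0, a 1] := by funext k; fin_cases k <;> rfl
  have h0 : a 0 ≠ 0 := by
    intro h0
    refine hq' (subset_closure ⟨τ.ψ 1 ![0, a 1], τ.ψ_ne (by decide) _ _, ?_⟩)
    rw [τ.proj_edge_zero, ← h0, ← ea]
  have h1 : a 1 ≠ 0 := by
    intro h1
    refine hq' (subset_closure ⟨τ.ψ 2 ![0, a 0], τ.ψ_ne (by decide) _ _, ?_⟩)
    rw [τ.proj_edge_one, ← h1, ← ea]
  obtain ⟨z', hz'⟩ := edge0 (a 1) h1
  have hW : τ.ψ 0 ![1, a 1] ∉ closure L.doubleSet :=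
    τ.notMem_closure_doubleSet (by simp) (by simpa using h1)
  rw [← hz _ h1 hW, hz' _ one_ne_zero hW]
  generalize a 0 = x, a 1 = y at *
  subst ea
  exact hz' _ h0 _

theorem exists_constNear (hL : L.IsGeneric)
    (hf : ∀ χ : DoubleChart L, f (χ.semiSheet 0 1) = f (χ.semiSheet 0 (-1))) {p : F}
    (hp : p ∉ closure L.lowerSet) : ∃ z, ConstNear f p z := by
  rcases hL.cases_of_notMem_lowerSet hp with h | ⟨χ, rfl⟩ | ⟨τ, rfl⟩
  · exact ⟨_, constNear_of_notMem_doubleSet h⟩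
  · exact ⟨_, constNear_double hf χ⟩
  · exact constNear_triple hL hf τ

/-- The semi-sheets are dense in the sheets. -/
theorem IsGeneric.exists_mem_of_mem_nhds (hL : L.IsGeneric) {p : F} (hp : p ∉ closure L.lowerSet)
    {U : Set F} (hU : U ∈ 𝓝 p) : ∃ q ∈ U, q ∉ closure L.doubleSet := by
  have aux : ∀ (ψ : Plane → F) (a : Plane), Continuous ψ → ψ 0 = p →
      (∀ t : ℝ, t ≠ 0 → ψ (t • a) ∉ closure L.doubleSet) → ∃ q ∈ U, q ∉ closure L.doubleSet := by
    intro ψ a hψ h0 h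
    have hc : Continuous (fun t : ℝ => ψ (t • a)) := hψ.comp (by fun_prop)
    have h' : ∀ᶠ t in 𝓝[≠] (0 : ℝ), ψ (t • a) ∈ U :=
      nhdsWithin_le_nhds (hc.tendsto 0 (by simpa [h0] using hU))
    obtain ⟨t, ht, ht0⟩ := (h'.and self_mem_nhdsWithin).exists
    exact ⟨_, ht, h t ht0⟩
  rcases hL.cases_of_notMem_lowerSet hp with h | ⟨χ, rfl⟩ | ⟨τ, rfl⟩
  · exact ⟨p, mem_of_mem_nhds hU, h⟩
  -- The diagonal direction `(1, 1)` leaves both coordinate axes at once, so it serves for double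
  -- and triple points alike.
  · exact aux _ 1 (χ.isOpenEmbedding 0).continuous rfl fun t ht =>
      χ.notMem_closure_doubleSet 0 (by simpa using ht)
  · exact aux _ 1 (τ.isOpenEmbedding 0).continuous rfl fun t ht =>
      τ.notMem_closure_doubleSet (by simpa using ht) (by simpa using ht)

/-- The components of the open complement of the closed lower set are open, so the dense semi-sheets
meet each of them. -/
theorem IsGeneric.sheet_surjective (hL : L.IsGeneric) :
    Function.Surjective (SemiSheet.sheet : L.SemiSheet → L.Sheet) := by
  intro σ
  obtain ⟨⟨p, hp⟩, rfl⟩ := ConnectedComponents.surjective_coe σ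
  have : LocallyConnectedSpace F :=
    ChartedSpace.locallyConnectedSpace (EuclideanSpace ℝ (Fin 2)) F
  have hopen : IsOpen (closure L.lowerSet)ᶜ := isClosed_closure.isOpen_compl
  have hmem : p ∈ connectedComponentIn (closure L.lowerSet)ᶜ p := mem_connectedComponentIn hp
  obtain ⟨q, hq, hqW⟩ := hL.exists_mem_of_mem_nhds hp (hopen.connectedComponentIn.mem_nhds hmem)
  exact ⟨L.semiSheetAt q hqW, sheetAt_eq isPreconnected_connectedComponentIn
    (fun x hx => connectedComponentIn_subset _ _ hx) hq hmem _ _⟩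

theorem ConstNear.unique (hL : L.IsGeneric) {p : F} (hp : p ∉ closure L.lowerSet) {z z' : Z}
    (h : ConstNear f p z) (h' : ConstNear f p z') : z = z' := by
  obtain ⟨q, ⟨h1, h2⟩, hq⟩ := hL.exists_mem_of_mem_nhds hp (h.and h')
  exact (h1 hq).symm.trans (h2 hq)

/-- A function on the semi-sheets that takes the same value on the two sides of every double point
curve in an upper sheet is a function of the sheet. -/
theorem IsGeneric.eq_of_sheet_eq (hL : L.IsGeneric)
    (hf : ∀ χ : DoubleChart L, f (χ.semiSheet 0 1) = f (χ.semiSheet 0 (-1))) {s t : L.SemiSheet}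
    (h : s.sheet = t.sheet) : f s = f t := by
  obtain ⟨⟨p, hp⟩, rfl⟩ := ConnectedComponents.surjective_coe s
  obtain ⟨⟨q, hq⟩, rfl⟩ := ConnectedComponents.surjective_coe t
  have hlow : ∀ {x}, x ∉ closure L.doubleSet → x ∉ closure L.lowerSet := fun hx h' =>
    hx (closure_mono L.lowerSet_subset h')
  set z := f (L.semiSheetAt p hp) with hz
  -- The set where `f` has local value `z` is closed because every point has some local value, and
  -- local values are unique by density. Being clopen, it contains the whole sheet of `p`.
  have hcl : IsClopen {x : {x : F // x ∉ closure L.lowerSet} | ConstNear f x.1 z} := by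
    have hev : ∀ (x : {x : F // x ∉ closure L.lowerSet}) {z'}, ConstNear f x.1 z' →
        ∀ᶠ y : {x : F // x ∉ closure L.lowerSet} in 𝓝 x, ConstNear f y.1 z' := fun x z' hx =>
      (continuous_subtype_val.tendsto x).eventually (eventually_eventually_nhds.2 hx)
    refine ⟨⟨isOpen_iff_mem_nhds.2 fun x hx => ?_⟩, isOpen_iff_mem_nhds.2 fun x hx => hev x hx⟩
    obtain ⟨z', hz'⟩ := exists_constNear hL hf x.2
    have hne : z' ≠ z := by
      rintro rfl
      exact hx hz'
    filter_upwards [hev x hz'] with y hy hy'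
    exact hne (hy.unique hL y.2 hy')
  have hmem : (⟨q, hlow hq⟩ : {x : F // x ∉ closure L.lowerSet}) ∈
      connectedComponent (⟨p, hlow hp⟩ : {x : F // x ∉ closure L.lowerSet}) :=
    ConnectedComponents.coe_eq_coe'.1 h.symm
  have hcn : ConstNear f q z :=
    hcl.connectedComponent_subset (constNear_of_notMem_doubleSet hp) hmem
  exact (hcn.self_of_nhds hq).symm

theorem IsGeneric.exists_sheet_factor (hL : L.IsGeneric)
    (hf : ∀ χ : DoubleChart L, f (χ.semiSheet 0 1) = f (χ.semiSheet 0 (-1))) :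
    ∃ g : L.Sheet → Z, ∀ s : L.SemiSheet, g s.sheet = f s :=
  ⟨fun σ => f (Function.surjInv hL.sheet_surjective σ), fun s =>
    hL.eq_of_sheet_eq hf (Function.surjInv_eq hL.sheet_surjective s.sheet)⟩

end Extension

/-! ### The correspondence of colorings -/

section Correspondence

variable {X : Type v} [Quandle X] {Y : Type w} [MulAction (AssocGroup X)ᵐᵒᵖ Y]

theorem _root_.QuandleDouble.act_mk (x y : X) (ε : ℤˣ) :
    (⟨y, 1⟩ : QuandleDouble X) ◃ ⟨x, ε⟩ = ⟨y ◃ x, ε⟩ := by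
  change (⟨QuandleDouble.signedAct 1 y x, ε⟩ : QuandleDouble X) = _
  rw [QuandleDouble.signedAct_one]

theorem _root_.QuandleDouble.op_of_smul (x : X) (ε : ℤˣ) (r : Y) :
    MulOpposite.op (SymAssocGroup.of (⟨x, ε⟩ : QuandleDouble X)) • r =
      MulOpposite.op (AssocGroup.of x ^ (ε : ℤ)) • r := by
  have h : QuandleDouble.toAssocGroup X (SymAssocGroup.of ⟨x, ε⟩) = AssocGroup.of x ^ (ε : ℤ) :=
    PresentedGroup.toGroup.of _
  rw [← h]
  rfl

theorem _root_.QuandleDouble.op_of_one_smul (x : X) (r : Y) :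
    MulOpposite.op (SymAssocGroup.of (⟨x, 1⟩ : QuandleDouble X)) • r =
      MulOpposite.op (AssocGroup.of x) • r := by
  simp [QuandleDouble.op_of_smul]

theorem _root_.QuandleDouble.op_of_neg_one_smul (x : X) (r : Y) :
    MulOpposite.op (SymAssocGroup.of (⟨x, -1⟩ : QuandleDouble X)) • r =
      (MulOpposite.op (AssocGroup.of x))⁻¹ • r := by
  simp [QuandleDouble.op_of_smul]

/-- The label of a semi-sheet that belongs to an `X`-coloring. -/
def doubleLabel (c : L.Sheet → X) (s : L.SemiSheet) : QuandleDouble X := ⟨c s.sheet, 1⟩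

/-- An `X`-coloring of the diagram with orientation `o` gives a valid assignment with normal
orientations from `o`. -/
theorem isValid_of_isColoring {o : L.Orientation} {c : L.Sheet → X} (hc : L.IsColoring X o c)
    {A : Assignment L (QuandleDouble X)} (hA : A.Follows o) (hl : A.label = doubleLabel c) :
    A.IsValid where
  over_coherent χ _ := by simp only [hl, doubleLabel, χ.sheet_semiSheet]
  over_incoherent χ h := absurd (hA.coherent χ 0) h
  under_coherent χ δ ε hd _ := by
    have h := hc χ ε ⟨_, χ.mem_immersedSet 0 0⟩ rfl ((hA.directed_iff χ 0 δ ε 0).1 hd)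
    simp only [hl, doubleLabel, χ.sheet_semiSheet, QuandleDouble.act_mk, h]
  under_incoherent χ δ ε _ h := absurd (hA.coherent χ 1) h

theorem isColoring_of_isValid {o : L.Orientation} {c : L.Sheet → X}
    {A : Assignment L (QuandleDouble X)} (hA : A.Follows o) (hl : A.label = doubleLabel c)
    (hv : A.IsValid) : L.IsColoring X o c := by
  rintro χ ε ⟨_, hp⟩ rfl ho
  -- Either upper half would do: both carry the label of the same sheet.
  have h := hv.under_coherent χ 1 ε ((hA.directed_iff χ 0 1 ε 0).2 ho) (hA.coherent χ 1)
  simp only [hl, doubleLabel, χ.sheet_semiSheet, QuandleDouble.act_mk] at h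
  exact congrArg QuandleDouble.elt h

/-- The condition is needed for every representative `B`. Where `B` is inverted, its normal points
from `γ₂` to `γ₁` for `o` and its label acts as `x⁻¹`, so `r₂ * x = r₁` is read as `r₁ * x⁻¹ = r₂`.
-/
theorem region_cond_of_follows {o : L.Orientation} {c : L.Sheet → X} {region : L.Region → Y}
    (hr : ∀ (s : L.SemiSheet) (p : L.immersedSet) (γ₁ γ₂ : L.Region), p.1 ∈ s.carrier →
      L.PointsFrom p.1 (o.side p) γ₁ γ₂ →
        MulOpposite.op (AssocGroup.of (c s.sheet)) • region γ₁ = region γ₂)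
    {A : {A : Assignment L (QuandleDouble X) // A.IsValid}} (hA : A.1.Follows o)
    (hl : A.1.label = doubleLabel c) (B : {A : Assignment L (QuandleDouble X) // A.IsValid})
    (hB : (Quot.mk _ B : L.SymColoring (QuandleDouble X)) = Quot.mk _ A) (s : L.SemiSheet)
    (p : s.carrier) (γ₁ γ₂ : L.Region) (h : L.PointsFrom p.1 ((B.1.normal s).side p) γ₁ γ₂) :
    MulOpposite.op (SymAssocGroup.of (B.1.label s)) • region γ₁ = region γ₂ := by
  have hp := (A.1.normal s).subset_immersedSet p.2
  have hside := hA s p.1 p.2 hp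
  have hls : A.1.label s = ⟨c s.sheet, 1⟩ := congrFun hl s
  rcases Assignment.inversionEquiv_of_eq hB.symm s with ⟨h1, h2⟩ | ⟨h1, h2⟩
  · rw [← h2, hls, QuandleDouble.op_of_one_smul]
    refine hr s ⟨p.1, hp⟩ γ₁ γ₂ p.2 ?_
    rwa [hside, h1]
  · have h3 : B.1.label s = ⟨c s.sheet, -1⟩ := by rw [h2, hls]; rfl
    rw [h3, QuandleDouble.op_of_neg_one_smul, inv_smul_eq_iff]
    refine (hr s ⟨p.1, hp⟩ γ₂ γ₁ p.2 ?_).symm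
    rw [hside]
    exact PointsFrom.swap h1.symm p h

/-! ### The map to colorings by the symmetric double and its bijectivity -/

variable {o : L.Orientation} (A₀ : {A : Assignment L (QuandleDouble X) // A.IsValid})
  (h₀ : A₀.1.Follows o)

/-- The canonical form of the coloring by the symmetric double that corresponds to an
`X_Y`-coloring. The assignment `A₀` only provides normal orientations that follow `o`. -/
def ShadowColoring.canonicalForm (c : L.ShadowColoring X Y o) :
    {A : Assignment L (QuandleDouble X) // A.IsValid} :=
  ⟨⟨A₀.1.normal, doubleLabel c.color⟩,
    isValid_of_isColoring c.isColoring (A := ⟨A₀.1.normal, doubleLabel c.color⟩) h₀ rfl⟩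

/-- The coloring by the symmetric double that corresponds to an `X_Y`-coloring. -/
def ShadowColoring.toSym (c : L.ShadowColoring X Y o) :
    L.SymShadowColoring (QuandleDouble X) Y where
  color := Quot.mk _ (c.canonicalForm A₀ h₀)
  region := c.region
  region_cond := region_cond_of_follows c.region_cond (A := c.canonicalForm A₀ h₀) h₀ rfl

theorem ShadowColoring.isCanonicalForm (c : L.ShadowColoring X Y o) :
    IsCanonicalForm (c.toSym A₀ h₀).color (c.canonicalForm A₀ h₀) :=
  ⟨rfl, fun _ => rfl⟩

theorem ShadowColoring.induces_toSym (c : L.ShadowColoring X Y o) : (c.toSym A₀ h₀).Induces o :=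
  ⟨_, c.isCanonicalForm A₀ h₀, h₀⟩

/-- The unique canonical form remembers the label of every semi-sheet, and every sheet contains a
semi-sheet. -/
theorem ShadowColoring.toSym_injective (hL : L.IsGeneric) :
    Function.Injective (ShadowColoring.toSym (Y := Y) A₀ h₀) := by
  rintro ⟨c, hc, r, hr⟩ ⟨c', hc', r', hr'⟩ h
  have hcol := congrArg SymShadowColoring.color h
  have hreg : r = r' := congrArg SymShadowColoring.region h
  have hA := (ShadowColoring.isCanonicalForm A₀ h₀ ⟨c, hc, r, hr⟩).unique
    (hcol ▸ ShadowColoring.isCanonicalForm A₀ h₀ ⟨c', hc', r', hr'⟩)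
  have hl : doubleLabel c = doubleLabel c' := congrArg (fun A => A.1.label) hA
  have hcc : c = c' := by
    funext σ
    obtain ⟨s, rfl⟩ := hL.sheet_surjective σ
    exact congrArg QuandleDouble.elt (congrFun hl s)
  subst hcc hreg
  rfl

/-- Coherence along `o` lets the labels of the canonical form descend to sheets. Its normals agree
with those of `A₀` since both follow `o`, so the rebuilt canonical form is the original one. -/
theorem ShadowColoring.exists_toSym_eq (hL : L.IsGeneric)
    {C : L.SymShadowColoring (QuandleDouble X) Y} (hC : C.Induces o) :
    ∃ c : L.ShadowColoring X Y o, c.toSym A₀ h₀ = C := by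
  obtain ⟨A, hcan, hA⟩ := hC
  obtain ⟨c, hc⟩ := hL.exists_sheet_factor (f := fun s => (A.1.label s).elt) fun χ =>
    congrArg QuandleDouble.elt (A.2.over_coherent χ (Assignment.Follows.coherent hA χ 0))
  have hl : A.1.label = doubleLabel c := by
    funext s
    exact QuandleDouble.ext (hc s).symm (hcan.2 s)
  have hn : A₀.1.normal = A.1.normal := h₀.normal_eq hA
  let c' : L.ShadowColoring X Y o :=
    { color := c
      isColoring := isColoring_of_isValid hA hl A.2
      region := C.region
      region_cond := by
        intro s p γ₁ γ₂ hp h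
        rw [← QuandleDouble.op_of_one_smul]
        have hls : A.1.label s = ⟨c s.sheet, 1⟩ := congrFun hl s
        rw [← hls]
        refine C.region_cond A hcan.1 s ⟨p.1, hp⟩ γ₁ γ₂ ?_
        rwa [← hA s p.1 hp p.2] }
  have hAc : c'.canonicalForm A₀ h₀ = A := Subtype.ext (Assignment.ext hn hl.symm)
  have hcol : (c'.toSym A₀ h₀).color = C.color := by
    rw [← hcan.1, ← hAc]
    rfl
  refine ⟨c', ?_⟩
  obtain ⟨col, reg, hreg⟩ := C
  change (⟨(c'.toSym A₀ h₀).color, reg, _⟩ : L.SymShadowColoring (QuandleDouble X) Y) = _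
  congr

/-- The colorings that are orientation equivalent to a coloring inducing `o` are those that
induce `o`. -/
theorem SymShadowColoring.oriEquiv_iff {C C' : L.SymShadowColoring (QuandleDouble X) Y}
    (hC : C.Induces o) : C.OriEquiv C' ↔ C'.Induces o := by
  refine ⟨fun h => (h o).1 hC, ?_⟩
  rintro ⟨A', hcan', hA'⟩ o'
  obtain ⟨A, hcan, hA⟩ := hC
  have hn : A.1.normal = A'.1.normal := Assignment.Follows.normal_eq hA hA'
  rw [induces_iff hcan, induces_iff hcan', Assignment.Follows, Assignment.Follows, hn]

/-- The correspondence between `Col_{X_Y}(D, o)` and the orientation equivalence class of a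
coloring that induces `o`. -/
theorem nonempty_shadowColoring_equiv (hL : L.IsGeneric)
    (C : L.SymShadowColoring (QuandleDouble X) Y) (hC : C.Induces o) :
    Nonempty (L.ShadowColoring X Y o ≃ C.oriClass) := by
  -- `C` itself supplies normal orientations of the semi-sheets that follow `o`; its labels play no
  -- role in the map.
  obtain ⟨A₀, -, h₀⟩ := id hC
  refine ⟨Equiv.ofBijective (fun c => ⟨c.toSym A₀ h₀,
    (SymShadowColoring.oriEquiv_iff hC).2 (c.induces_toSym A₀ h₀)⟩) ⟨?_, ?_⟩⟩
  · intro c c' h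
    exact ShadowColoring.toSym_injective A₀ h₀ hL (congrArg Subtype.val h)
  · rintro ⟨C', hC'⟩
    obtain ⟨c, hc⟩ :=
      ShadowColoring.exists_toSym_eq A₀ h₀ hL ((SymShadowColoring.oriEquiv_iff hC).1 hC')
    exact ⟨c, Subtype.ext hc⟩

end Correspondence

end SurfaceLink

theorem mainTheorem12 {F : Type u} [TopologicalSpace F] [T2Space F] [CompactSpace F]
    [ChartedSpace (EuclideanSpace ℝ (Fin 2)) F] (D : SurfaceLinkDiagram F)
    {X : Type v} [Quandle X] {Y : Type w} [MulAction (AssocGroup X)ᵐᵒᵖ Y]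
    (o : D.Orientation) (C : D.SymShadowColoring (QuandleDouble X) Y) (hC : C.Induces o) :
    Nonempty (D.ShadowColoring X Y o ≃ C.oriClass) ∧
      Cardinal.mk (D.ShadowColoring X Y o) = Cardinal.mk C.oriClass := by
  have h := SurfaceLink.nonempty_shadowColoring_equiv D.generic C hC
  exact ⟨h, Cardinal.eq.2 h⟩
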